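/- Let $X$ be a finite connected CW complex with fundamental group $G=\pi_1(X,x_0)$ and universal covering $\widetilde X$, let $C_*(\widetilde X)$ be the cellular chain complex of $\widetilde X$ with its $G$-action, and let $\rho:G\to \mathrm{GL}(l,\mathbb C)$ be a representation. For an integral domain $B$ with fraction field $\{B\}$ and a representation $\sigma:G\to\mathrm{GL}(l,B)$ put $$\beta_k(X,\sigma)=\dim_{\{B\}}\Big(H_k\big(C_*(\widetilde X)\otimes_\sigma B^l\big)\otimes_B\{B\}\Big),\qquad \beta^k(X,\sigma)=\dim_{\{B\}}\Big(H^k\big(\mathrm{Hom}_G(C_*(\widetilde X),B^l)\big)\otimes_B\{B\}\Big),$$ where in the tensor product $C_*(\widetilde X)$ is a right $G$-module through $x\cdot g=g^{-1}x$. Let $\rho^\vee(g)={}^t\rho(g)^{-1}$ be the contragredient representation. Let $\alpha\in H^1(X,\mathbb C)=\mathrm{Hom}(G,\mathbb C)$, let $m=\mathrm{Irr}\,\alpha$ be the rank of the group $\alpha(G)$, and factor $\alpha$ as $$G\xrightarrow{\ \phi\ }H_1(X,\mathbb Z)/\mathrm{Tors}\cong\mathbb Z^n\xrightarrow{\ p\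 }\mathbb Z^m\xrightarrow{\ \widetilde\alpha\ }\mathbb C$$ with $p$ an epimorphism and $\widetilde\alpha$ a monomorphism. Let $$\gamma_t(g)=e^{t\langle\alpha,g\rangle}\rho(g)\in\mathrm{GL}(l,\mathbb C)\quad(t\in\mathbb C),\qquad \widehat\gamma(g)=e^{t\langle\alpha,g\rangle}\rho(g)\in\mathrm{GL}(l,\mathbb C[[t]])$$ be the exponential and the formal exponential deformation of $\rho$. Let $L_m=\mathbb C[\mathbb Z^m]$, with fraction field $\{L_m\}$, let $\rho_p=\rho\otimes(p\circ\phi):G\to\mathrm{GL}(l,L_m)$, and put $$b_k(X,\rho,p)=\dim_{\{L_m\}}H_k\big(C_*(\widetilde X)\otimes_{\rho_p}\{L_m\}^l\big).$$ Then for every $k\ge 0$ the following holds. 1) There is a closed discrete set $S_k\subset\mathbb C$ such that for all $t\in\mathbb C\setminus S_k$ $$\beta_k(X,\gamma_t)=\beta_k(X,\widehat\gamma)=b_k(X,\rho,p)\qquad\text{and}\qquad \beta^k(X,\gamma_t)=\beta^k(X,\widehat\gamma)=b_k(X,\rho^\vee,p).$$ 2) Suppose that $\alpha\in H^1(X,\mathbb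 R)$, so that $\widetilde\alpha$ takes values in $\mathbb R$. Let $\widehat L$ be the Novikov completion of $L_m$, that is, the ring of formal series $\lambda=\sum_{a\in\mathbb Z^m}n_a a$ ($n_a\in\mathbb C$) such that for every $C\in\mathbb R$ the set $\{a\in\operatorname{supp}\lambda:\widetilde\alpha(a)\ge C\}$ is finite, and let $\widehat b_k^\rho(X,\alpha)$ be the rank over $\widehat L$ of $H_k\big(C_*(\widetilde X)\otimes_{\rho_p}\widehat L^{\,l}\big)$. Then also, for $t\in\mathbb C\setminus S_k$, $$\beta_k(X,\gamma_t)=\beta_k(X,\widehat\gamma)=\widehat b_k^\rho(X,\alpha)\qquad\text{and}\qquad \beta^k(X,\gamma_t)=\beta^k(X,\widehat\gamma)=\widehat b_k^{\rho^\vee}(X,\alpha).$$ -/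

import Mathlib

open scoped TensorProduct Matrix

noncomputable section

namespace ExpDeform

/-! ## The universal covering of a CW complex and its cellular chain complex -/

section UniversalCover

open Topology CategoryTheory

/-- The closed unit cube `[-1,1]ⁿ`, the domain of the characteristic maps of `n`-cells. -/
abbrev Cube (n : ℕ) : Type := Metric.closedBall (0 : Fin n → ℝ) 1

/-- The open unit cube. -/
abbrev OpenCube (n : ℕ) : Type := Metric.ball (0 : Fin n → ℝ) 1

/-- The boundary of the unit cube. -/
abbrev CubeBoundary (n : ℕ) : Type := Metric.sphere (0 : Fin n → ℝ) 1

def OpenCube.toCube {n : ℕ} (y : OpenCube n) : Cube n :=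
  ⟨y.1, Metric.ball_subset_closedBall y.2⟩

def CubeBoundary.toCube {n : ℕ} (y : CubeBoundary n) : Cube n :=
  ⟨y.1, Metric.sphere_subset_closedBall y.2⟩

variable {X : Type*} [TopologicalSpace X]

/-- The (underlying set of the) universal covering `X̃`: homotopy classes, relative to the end
points, of paths in `X` that start at the base point. Only its points are needed below. -/
def UnivCover (x₀ : X) : Type _ := Σ x : X, Path.Homotopic.Quotient x₀ x

/-- The left action of the fundamental group on homotopy classes of paths that start at `x₀`.
In Mathlib the product `g * h` in `FundamentalGroup X x₀` is the class of "first `h`, then `g`",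
so that the left action is `g • w = g⁻¹ · w` (first `g⁻¹`, then `w`). -/
def actPath {x₀ x : X} (g : FundamentalGroup X x₀) (w : Path.Homotopic.Quotient x₀ x) :
    Path.Homotopic.Quotient x₀ x :=
  (FundamentalGroup.toPath g).symm.trans w

theorem actPath_one {x₀ x : X} (w : Path.Homotopic.Quotient x₀ x) :
    actPath (1 : FundamentalGroup X x₀) w = w := by
  induction w using Path.Homotopic.Quotient.ind with
  | mk w =>
    simp only [actPath, FundamentalGroup.toPath, FundamentalGroup.one_def]
    rw [← Path.Homotopic.Quotient.mk_refl, ← Path.Homotopic.Quotient.mk_symm]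
    simp

theorem actPath_mul {x₀ x : X} (g h : FundamentalGroup X x₀)
    (w : Path.Homotopic.Quotient x₀ x) :
    actPath (g * h) w = actPath g (actPath h w) := by
  unfold actPath
  rw [← Path.Homotopic.Quotient.trans_assoc]
  congr 1
  exact mul_inv_rev g h

instance (x₀ : X) : MulAction (FundamentalGroup X x₀) (UnivCover x₀) where
  smul g P := ⟨P.1, actPath g P.2⟩
  one_smul P := Sigma.ext rfl (heq_of_eq (actPath_one P.2))
  mul_smul g h P := Sigma.ext rfl (heq_of_eq (actPath_mul g h P.2))

variable [CWComplex (Set.univ : Set X)]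

/-- The `n`-cells of the CW complex `X`. -/
abbrev XCell (X : Type*) [TopologicalSpace X] [CWComplex (Set.univ : Set X)] (n : ℕ) : Type _ :=
  RelCWComplex.cell (Set.univ : Set X) n

/-- The characteristic map of an `n`-cell of `X`. -/
def charMap {n : ℕ} (i : XCell X n) (y : Cube n) : X :=
  RelCWComplex.map (C := (Set.univ : Set X)) n i y.1

/-- The centre of an `n`-cell of `X`. -/
def cellCenter {n : ℕ} (i : XCell X n) : X :=
  RelCWComplex.map (C := (Set.univ : Set X)) n i 0

/-- The image under the characteristic map of the segment from the centre of the cube to `y`. -/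
def charPath {n : ℕ} (i : XCell X n) (y : Cube n) : Path (cellCenter i) (charMap i y) where
  toFun s := RelCWComplex.map (C := (Set.univ : Set X)) n i ((s : ℝ) • y.1)
  continuous_toFun := by
    refine (RelCWComplex.continuousOn (C := (Set.univ : Set X)) n i).comp_continuous
      (by fun_prop) fun s => ?_
    have hy := y.2
    rw [mem_closedBall_zero_iff] at hy ⊢
    rw [norm_smul, Real.norm_of_nonneg s.2.1]
    exact mul_le_one₀ s.2.2 (norm_nonneg _) hy
  source' := by simp [cellCenter]
  target' := by simp [charMap]

/-- The `n`-cells of `X̃`: the lifts of the `n`-cells of `X`, a lift being given by a point of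
`X̃` over the centre of the cell. -/
def LiftedCell (x₀ : X) (n : ℕ) : Type _ :=
  Σ i : XCell X n, Path.Homotopic.Quotient x₀ (cellCenter i)

instance (x₀ : X) (n : ℕ) : MulAction (FundamentalGroup X x₀) (LiftedCell x₀ n) where
  smul g e := ⟨e.1, actPath g e.2⟩
  one_smul e := Sigma.ext rfl (heq_of_eq (actPath_one e.2))
  mul_smul g h e := Sigma.ext rfl (heq_of_eq (actPath_mul g h e.2))

/-- The characteristic map of a cell of `X̃`: the lift of the characteristic map of the cell of
`X` that takes the centre of the cube to the given point. -/
def liftedCharMap {x₀ : X} {n : ℕ} (e : LiftedCell x₀ n) (y : Cube n) : UnivCover x₀ :=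
  ⟨charMap e.1 y, e.2.trans (Path.Homotopic.Quotient.mk (charPath e.1 y))⟩

theorem liftedCharMap_smul {x₀ : X} {n : ℕ} (g : FundamentalGroup X x₀) (e : LiftedCell x₀ n)
    (y : Cube n) : liftedCharMap (g • e) y = g • liftedCharMap e y :=
  Sigma.ext rfl (heq_of_eq (Path.Homotopic.Quotient.trans_assoc _ _ _))

open Classical in
/-- The point of the cube with the property `P`, if there is one, and `∞` otherwise. -/
def pointOrInfty {n : ℕ} (P : OpenCube n → Prop) : OnePoint (OpenCube n) :=
  if h : ∃ y, P y then ((h.choose : OpenCube n) : OnePoint (OpenCube n)) else OnePoint.infty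

/-- The collapse of the complement of the open cell `e'` to a point: the inverse of the
characteristic map on the open cell `e'`, and `∞` outside it. The quotient of the `n`-skeleton by
the complement of `e'` is identified in this way with the one-point compactification of the open
cube, which is an `n`-sphere. -/
def collapse {x₀ : X} {n : ℕ} (e' : LiftedCell x₀ n) (P : UnivCover x₀) :
    OnePoint (OpenCube n) :=
  pointOrInfty fun y => liftedCharMap e' y.toCube = P

theorem collapse_smul {x₀ : X} {n : ℕ} (g : FundamentalGroup X x₀) (e' : LiftedCell x₀ n)
    (P : UnivCover x₀) : collapse (g • e') (g • P) = collapse e' P := by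
  unfold collapse
  simp only [liftedCharMap_smul, smul_left_cancel_iff]

/-- The first `n` coordinates of a point of the boundary of the `(n+1)`-cube. -/
def firstCoords {n : ℕ} (x : CubeBoundary (n + 1)) : Fin n → ℝ := fun i => x.1 i.castSucc

open Classical in
/-- The reference map of degree one from the boundary of the `(n+1)`-cube to the one-point
compactification of the open `n`-cube: the open face on which the last coordinate equals `1` is
projected to the open `n`-cube, and all the rest goes to `∞`. -/
def referenceMap (n : ℕ) (x : CubeBoundary (n + 1)) : OnePoint (OpenCube n) :=
  if h : x.1 (Fin.last n) = 1 ∧ firstCoords x ∈ Metric.ball (0 : Fin n → ℝ) 1 then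
    ((⟨firstCoords x, h.2⟩ : OpenCube n) : OnePoint (OpenCube n))
  else OnePoint.infty

theorem referenceMap_continuous (n : ℕ) : Continuous (referenceMap n) := by
  have hlast : Continuous fun z : CubeBoundary (n + 1) => z.1 (Fin.last n) :=
    (continuous_apply _).comp continuous_subtype_val
  have hinit : Continuous fun z : CubeBoundary (n + 1) => firstCoords z :=
    continuous_pi fun i => (continuous_apply _).comp continuous_subtype_val
  have hone (z : CubeBoundary (n + 1)) (h0 : 0 < z.1 (Fin.last n))
      (hb : firstCoords z ∈ Metric.ball (0 : Fin n → ℝ) 1) : z.1 (Fin.last n) = 1 := by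
    have hz := mem_sphere_zero_iff_norm.mp z.2
    rw [mem_ball_zero_iff] at hb
    by_contra hne
    have hle := (norm_le_pi_norm z.1 (Fin.last n)).trans_eq hz
    rw [Real.norm_of_nonneg h0.le] at hle
    have : ‖z.1‖ < 1 := by
      rw [pi_norm_lt_iff one_pos]
      intro i
      induction i using Fin.lastCases with
      | last => rw [Real.norm_of_nonneg h0.le]; exact lt_of_le_of_ne hle hne
      | cast i => exact (norm_le_pi_norm (firstCoords z) i).trans_lt hb
    exact absurd hz this.ne
  rw [continuous_def]
  intro U hU
  rw [OnePoint.isOpen_def] at hU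
  by_cases hU' : OnePoint.infty ∈ U
  · have hK : IsCompact ((↑) ⁻¹' U : Set (OpenCube n))ᶜ := hU.1 hU'
    have hK' := hK.image continuous_subtype_val
    have : referenceMap n ⁻¹' U =
        ({z | z.1 (Fin.last n) = 1} ∩ {z | firstCoords z ∈
          (Subtype.val '' ((↑) ⁻¹' U : Set (OpenCube n))ᶜ : Set (Fin n → ℝ))})ᶜ := by
      ext z
      by_cases h : z.1 (Fin.last n) = 1 ∧ firstCoords z ∈ Metric.ball (0 : Fin n → ℝ) 1
      · simp only [Set.mem_preimage, referenceMap, dif_pos h, Set.mem_compl_iff, Set.mem_inter_iff,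
          Set.mem_ofPred_eq, h.1, true_and, Set.mem_image, Subtype.exists, exists_and_right,
          exists_eq_right, not_exists, not_not]
        exact ⟨fun hz _ => hz, fun hz => hz h.2⟩
      · simp only [Set.mem_preimage, referenceMap, dif_neg h, hU', Set.mem_compl_iff,
          Set.mem_inter_iff, Set.mem_ofPred_eq, true_iff]
        rintro ⟨h1, y, -, hy⟩
        exact h ⟨h1, hy ▸ y.2⟩
    rw [this, isOpen_compl_iff]
    exact (isClosed_eq hlast continuous_const).inter (hK'.isClosed.preimage hinit)
  · have : referenceMap n ⁻¹' U = {z | 0 < z.1 (Fin.last n)} ∩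
        {z | firstCoords z ∈ (Subtype.val '' ((↑) ⁻¹' U : Set (OpenCube n)) : Set (Fin n → ℝ))} := by
      ext z
      by_cases h : z.1 (Fin.last n) = 1 ∧ firstCoords z ∈ Metric.ball (0 : Fin n → ℝ) 1
      · simp only [Set.mem_preimage, referenceMap, dif_pos h, Set.mem_inter_iff,
          Set.mem_ofPred_eq, h.1, zero_lt_one, true_and, Set.mem_image, Subtype.exists,
          exists_and_right, exists_eq_right]
        exact ⟨fun hz => ⟨h.2, hz⟩, fun hz => hz.2⟩
      · simp only [Set.mem_preimage, referenceMap, dif_neg h, hU', false_iff,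
          Set.mem_inter_iff, Set.mem_ofPred_eq]
        rintro ⟨h1, y, -, hy⟩
        have hb : firstCoords z ∈ Metric.ball (0 : Fin n → ℝ) 1 := hy ▸ y.2
        exact h ⟨hone z h1 hb, hb⟩
    rw [this]
    exact (isOpen_lt continuous_const hlast).inter
      ((Metric.isOpen_ball.isOpenMap_subtype_val _ hU.2).preimage hinit)

/-- The map induced in integral singular homology of degree `n`. -/
abbrev homologyMap {Y Z : Type} [TopologicalSpace Y] [TopologicalSpace Z] (n : ℕ) (f : C(Y, Z)) :=
  ((AlgebraicTopology.singularHomologyFunctor (ModuleCat.{0} ℤ) n).obj (ModuleCat.of ℤ ℤ)).map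
    (TopCat.ofHom f)

/-- The property that `d` is the degree of the continuous map `f` from the boundary of the
`(n+1)`-cube to the one-point compactification of the open `n`-cube (both are `n`-spheres, and
`n ≥ 1` is meant): in `n`-th homology `f` induces `d` times the map induced by the reference
map. -/
def HasDegree (n : ℕ) (f : CubeBoundary (n + 1) → OnePoint (OpenCube n)) (d : ℤ) : Prop :=
  ∃ hf : Continuous f,
    homologyMap n ⟨f, hf⟩ = d • homologyMap n ⟨referenceMap n, referenceMap_continuous n⟩

open Classical in
/-- The degree of a continuous map (for `n ≥ 1` it exists and is unique). -/
def degree (n : ℕ) (f : CubeBoundary (n + 1) → OnePoint (OpenCube n)) : ℤ :=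
  if h : ∃ d, HasDegree n f d then h.choose else 0

/-- The attaching map of the cell `e` followed by the collapse of the complement of `e'`. -/
def attachCollapse {x₀ : X} {n : ℕ} (e : LiftedCell x₀ (n + 1)) (e' : LiftedCell x₀ n) :
    CubeBoundary (n + 1) → OnePoint (OpenCube n) :=
  fun s => collapse e' (liftedCharMap e s.toCube)

open Classical in
/-- The incidence number `[e : e']` of an `(n+1)`-cell and an `n`-cell of `X̃`. For `n ≥ 1` it is
the degree of the attaching map of `e` followed by the collapse of the complement of `e'`. For
`n = 0` the cell `e` is a path in `X̃`, and `[e : e']` is `1` for its end point minus `1` for its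
starting point. -/
def incidence {x₀ : X} : ∀ {n : ℕ}, LiftedCell x₀ (n + 1) → LiftedCell x₀ n → ℤ
  | 0, e, e' =>
      (if liftedCharMap e ⟨fun _ => 1, by simp⟩ =
        liftedCharMap e' ⟨0, by simp⟩ then 1 else 0) -
      (if liftedCharMap e ⟨fun _ => -1, by simp⟩ =
        liftedCharMap e' ⟨0, by simp⟩ then 1 else 0)
  | n + 1, e, e' => degree (n + 1) (attachCollapse e e')

theorem incidence_smul {x₀ : X} {n : ℕ} (g : FundamentalGroup X x₀) (e : LiftedCell x₀ (n + 1))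
    (e' : LiftedCell x₀ n) : incidence (g • e) (g • e') = incidence e e' := by
  cases n with
  | zero =>
    have h (y : Cube 1) (z : Cube 0) :
        liftedCharMap (g • e) y = liftedCharMap (g • e') z ↔
          liftedCharMap e y = liftedCharMap e' z := by
      rw [liftedCharMap_smul, liftedCharMap_smul, smul_left_cancel_iff]
    classical
    exact congrArg₂ (fun a b : ℤ => a - b) (if_congr (h _ _) rfl rfl) (if_congr (h _ _) rfl rfl)
  | succ n =>
    have h : attachCollapse (g • e) (g • e') = attachCollapse e e' := by
      funext s
      simp only [attachCollapse, liftedCharMap_smul, collapse_smul]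
    simp only [incidence, h]

/-- The cellular chain group `C_n(X̃)`. -/
abbrev Chains (x₀ : X) (n : ℕ) : Type _ := LiftedCell x₀ n →₀ ℤ

/-- The left action of the fundamental group on `C_n(X̃)`. -/
def deck {x₀ : X} {n : ℕ} (g : FundamentalGroup X x₀) : Chains x₀ n →ₗ[ℤ] Chains x₀ n :=
  Finsupp.lmapDomain ℤ ℤ (fun e => g • e)

/-- The cellular boundary of an `(n+1)`-cell of `X̃`, the sum of all `[e : e'] e'`. Only finitely
many `e'` contribute, since the attaching sphere is compact. -/
def cellBoundary {x₀ : X} {n : ℕ} (e : LiftedCell x₀ (n + 1)) : Chains x₀ n :=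
  ∑ᶠ e' : LiftedCell x₀ n, Finsupp.single e' (incidence e e')

theorem cellBoundary_smul {x₀ : X} {n : ℕ} (g : FundamentalGroup X x₀)
    (e : LiftedCell x₀ (n + 1)) : cellBoundary (g • e) = deck g (cellBoundary e) := by
  unfold cellBoundary
  have hinj : Function.Injective (deck (x₀ := x₀) (n := n) g) :=
    Finsupp.mapDomain_injective (MulAction.injective g)
  have h := (deck (x₀ := x₀) (n := n) g).toAddMonoidHom.map_finsum_of_injective hinj
    (fun e' => Finsupp.single e' (incidence e e'))
  simp only [LinearMap.toAddMonoidHom_coe] at h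
  rw [h, ← finsum_comp_equiv (MulAction.toPerm g)]
  refine finsum_congr fun e' => ?_
  simp [deck, incidence_smul]

/-- The boundary operator `C_k(X̃) → C_{k-1}(X̃)` (zero for `k = 0`). -/
def boundary (x₀ : X) : ∀ k : ℕ, Chains x₀ k →ₗ[ℤ] Chains x₀ (k - 1)
  | 0 => 0
  | n + 1 => Finsupp.linearCombination ℤ (cellBoundary (x₀ := x₀) (n := n))

theorem boundary_deck {x₀ : X} (k : ℕ) (g : FundamentalGroup X x₀) (c : Chains x₀ k) :
    boundary x₀ k (deck g c) = deck g (boundary x₀ k c) := by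
  cases k with
  | zero => simp [boundary]
  | succ n =>
    induction c using Finsupp.induction_linear with
    | zero => simp
    | add c d hc hd => simp only [map_add, hc, hd]
    | single e a =>
      have h : deck g (Finsupp.single e a) = Finsupp.single (g • e) a := by simp [deck]
      rw [h]
      simp only [boundary, Finsupp.linearCombination_single, cellBoundary_smul, map_smul]

end UniversalCover

/-! ## Homology and cohomology with twisted coefficients -/

section Twisted

open Topology

variable {X : Type*} [TopologicalSpace X] [CWComplex (Set.univ : Set X)] {x₀ : X}
variable {B : Type*} [CommRing B] {l : ℕ}

/-- The relations of the tensor product `C_k(X̃) ⊗_σ B^l` over the group ring, where `C_k(X̃)` is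
a right module through `x · g = g⁻¹ x`: they are `(x · g) ⊗ v = x ⊗ σ(g) v`. -/
def tensorRelations (σ : FundamentalGroup X x₀ →* GL (Fin l) B) (k : ℕ) :
    Submodule B ((Fin l → B) ⊗[ℤ] Chains x₀ k) :=
  Submodule.span B {z | ∃ (g : FundamentalGroup X x₀) (v : Fin l → B) (x : Chains x₀ k),
    z = v ⊗ₜ[ℤ] deck g⁻¹ x - ((σ g).1 *ᵥ v) ⊗ₜ[ℤ] x}

/-- The twisted chain group `C_k(X̃) ⊗_σ B^l`. -/
abbrev TwChains (σ : FundamentalGroup X x₀ →* GL (Fin l) B) (k : ℕ) : Type _ :=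
  ((Fin l → B) ⊗[ℤ] Chains x₀ k) ⧸ tensorRelations σ k

/-- The boundary operator `∂ ⊗ id` of the twisted chain complex. -/
def twBoundary (σ : FundamentalGroup X x₀ →* GL (Fin l) B) (k : ℕ) :
    TwChains σ k →ₗ[B] TwChains σ (k - 1) :=
  Submodule.mapQ _ _ (TensorProduct.AlgebraTensorModule.lTensor B (Fin l → B) (boundary x₀ k)) <| by
    rw [tensorRelations, Submodule.span_le]
    rintro _ ⟨g, v, x, rfl⟩
    refine Submodule.subset_span ⟨g, v, boundary x₀ k x, ?_⟩
    simp [boundary_deck]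

/-- The homology `H_k(C_*(X̃) ⊗_σ B^l)`: cycles modulo boundaries. -/
abbrev TwHomology (σ : FundamentalGroup X x₀ →* GL (Fin l) B) (k : ℕ) : Type _ :=
  LinearMap.ker (twBoundary σ k) ⧸
    (LinearMap.range (twBoundary σ (k + 1))).comap (LinearMap.ker (twBoundary σ k)).subtype

/-- The twisted cochain group `Hom_G(C_k(X̃), B^l)`. -/
def TwCochains (σ : FundamentalGroup X x₀ →* GL (Fin l) B) (k : ℕ) :
    Submodule B (Chains x₀ k →ₗ[ℤ] (Fin l → B)) where
  carrier := {c | ∀ g x, c (deck g x) = (σ g).1 *ᵥ c x}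
  add_mem' := by
    intro c d hc hd g x
    simp [hc g x, hd g x, Matrix.mulVec_add]
  zero_mem' := by
    intro g x
    simp
  smul_mem' := by
    intro b c hc g x
    simp [hc g x, Matrix.mulVec_smul]

instance (σ : FundamentalGroup X x₀ →* GL (Fin l) B) (k : ℕ) : AddCommGroup (TwCochains σ k) :=
  Submodule.addCommGroup _

/-- The coboundary operator `Hom_G(C_{k-1}(X̃), B^l) → Hom_G(C_k(X̃), B^l)`, `c ↦ c ∘ ∂`. -/
def twCoboundary (σ : FundamentalGroup X x₀ →* GL (Fin l) B) (k : ℕ) :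
    TwCochains σ (k - 1) →ₗ[B] TwCochains σ k where
  toFun c := ⟨c.1 ∘ₗ boundary x₀ k, fun g x => by
    simp only [LinearMap.comp_apply, boundary_deck]
    exact c.2 g _⟩
  map_add' _ _ := rfl
  map_smul' _ _ := rfl

/-- The cocycles of degree `k`. -/
def twCocycles (σ : FundamentalGroup X x₀ →* GL (Fin l) B) (k : ℕ) :
    Submodule B (TwCochains σ k) :=
  LinearMap.ker (twCoboundary σ (k + 1))

/-- The cohomology `H^k(X, σ) = H^k(Hom_G(C_*(X̃), B^l))`: cocycles modulo coboundaries. -/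
abbrev TwCohomology (σ : FundamentalGroup X x₀ →* GL (Fin l) B) (k : ℕ) : Type _ :=
  twCocycles σ k ⧸ (LinearMap.range (twCoboundary σ k)).comap (twCocycles σ k).subtype

/-- The homological Betti number of `X` with respect to `σ`: the rank of `H_k(X, σ)`, that is, the
dimension of its localization over the fraction field of the integral domain `B`. -/
def bettiHomology (σ : FundamentalGroup X x₀ →* GL (Fin l) B) (k : ℕ) : ℕ :=
  Module.finrank (FractionRing B) (FractionRing B ⊗[B] TwHomology σ k)

/-- The cohomological Betti number of `X` with respect to `σ`: the dimension of the localization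
of `H^k(X, σ)` over the fraction field of the integral domain `B`. -/
def bettiCohomology (σ : FundamentalGroup X x₀ →* GL (Fin l) B) (k : ℕ) : ℕ :=
  Module.finrank (FractionRing B) (FractionRing B ⊗[B] TwCohomology σ k)

end Twisted

/-! ## Deformations of a representation -/

section Deformations

variable {G : Type*} [Group G] {l : ℕ}

/-- The tensor product of a representation over `R` with a character with values in the units of
an `R`-algebra `S`. -/
def twist {R S : Type*} [CommRing R] [CommRing S] [Algebra R S] (ρ : G →* GL (Fin l) R)
    (χ : G →* Sˣ) : G →* GL (Fin l) S where
  toFun g := Units.map (Matrix.scalar (Fin l) : S →+* Matrix (Fin l) (Fin l) S).toMonoidHom (χ g) *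
    Matrix.GeneralLinearGroup.map (algebraMap R S) (ρ g)
  map_one' := by simp
  map_mul' g h := by
    ext1
    have h1 := Matrix.scalar_commute (n := Fin l) (χ h : S) (fun _ => Commute.all _ _)
      ((ρ g).1.map (algebraMap R S))
    simp only [map_mul, mul_assoc]
    simp only [Units.val_mul]
    congr 1
    simp only [← mul_assoc]
    congr 1

/-- The contragredient representation `g ↦ ᵗρ(g)⁻¹`. -/
def contragredient {R : Type*} [CommRing R] (ρ : G →* GL (Fin l) R) : G →* GL (Fin l) R where
  toFun g := ⟨((ρ g)⁻¹).1ᵀ, (ρ g).1ᵀ, by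
    rw [← Matrix.transpose_mul]; simp, by
    rw [← Matrix.transpose_mul]; simp⟩
  map_one' := by
    ext1
    simp
  map_mul' g h := by
    ext1
    simp [Matrix.transpose_mul]

/-- The exponential deformation `γ_t(g) = e^{t⟨α,g⟩} ρ(g)`. -/
def expDeformation (ρ : G →* GL (Fin l) ℂ) (α : Additive G →+ ℂ) (t : ℂ) : G →* GL (Fin l) ℂ :=
  twist ρ (MonoidHom.toHomUnits
    { toFun := fun g => Complex.exp (t * α (Additive.ofMul g))
      map_one' := by simp
      map_mul' := fun g h => by simp [mul_add, Complex.exp_add] })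

/-- The formal power series `e^{ta}`. -/
def formalExp (a : ℂ) : PowerSeries ℂ := PowerSeries.rescale a (PowerSeries.exp ℂ)

/-- The formal exponential deformation `γ̂(g) = e^{t⟨α,g⟩} ρ(g)`, a representation over `ℂ[[t]]`. -/
def formalDeformation (ρ : G →* GL (Fin l) ℂ) (α : Additive G →+ ℂ) :
    G →* GL (Fin l) (PowerSeries ℂ) :=
  twist ρ (MonoidHom.toHomUnits
    { toFun := fun g => formalExp (α (Additive.ofMul g))
      map_one' := by
        ext n
        rcases n with _ | n <;> simp [formalExp, PowerSeries.coeff_one]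
      map_mul' := fun g h => by
        simp [formalExp, PowerSeries.exp_mul_exp_eq_exp_add] })

/-- The ring `L_m = R[ℤ^m]` of Laurent polynomials in `m` variables. -/
abbrev Laurent (R : Type*) [CommRing R] (m : ℕ) : Type _ := AddMonoidAlgebra R (Fin m → ℤ)

/-- The tensor product of the representation `ρ` and of a homomorphism `q : G → ℤ^m`, regarded as
a representation over `L_m`. -/
def laurentRep {R : Type*} [CommRing R] {m : ℕ} (ρ : G →* GL (Fin l) R)
    (q : G →* Multiplicative (Fin m → ℤ)) : G →* GL (Fin l) (Laurent R m) :=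
  twist ρ (MonoidHom.toHomUnits ((AddMonoidAlgebra.of R (Fin m → ℤ)).comp q))

/-! ## The Novikov ring -/

/-- The group `ℤ^m`, with the partial order in which `a < b` means `η b < η a`. -/
def NovExp {m : ℕ} (_η : (Fin m → ℤ) →+ ℝ) : Type := Fin m → ℤ

instance {m : ℕ} (η : (Fin m → ℤ) →+ ℝ) : AddCommGroup (NovExp η) :=
  inferInstanceAs (AddCommGroup (Fin m → ℤ))

/-- The value of `η` at an exponent. -/
def NovExp.height {m : ℕ} {η : (Fin m → ℤ) →+ ℝ} : NovExp η →+ ℝ := η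

instance {m : ℕ} (η : (Fin m → ℤ) →+ ℝ) : PartialOrder (NovExp η) where
  le a b := a = b ∨ b.height < a.height
  le_refl a := Or.inl rfl
  le_trans a b c := by
    rintro (rfl | h) (rfl | h')
    · exact Or.inl rfl
    · exact Or.inr h'
    · exact Or.inr h
    · exact Or.inr (h'.trans h)
  le_antisymm a b := by
    rintro (rfl | h) (h' | h')
    · rfl
    · rfl
    · exact h'.symm
    · exact absurd h (not_lt.mpr h'.le)

theorem NovExp.le_def {m : ℕ} {η : (Fin m → ℤ) →+ ℝ} (a b : NovExp η) :
    a ≤ b ↔ a = b ∨ b.height < a.height := Iff.rfl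

instance {m : ℕ} (η : (Fin m → ℤ) →+ ℝ) : IsOrderedCancelAddMonoid (NovExp η) where
  add_le_add_left a b h c := by
    rw [NovExp.le_def] at h ⊢
    rcases h with rfl | h
    · exact Or.inl rfl
    · right; simpa using h
  le_of_add_le_add_left a b c h := by
    rw [NovExp.le_def] at h ⊢
    rcases h with h | h
    · exact Or.inl (add_left_cancel h)
    · right; simpa using h

/-- A set of exponents that is finite in the direction of `η`. -/
def NovFinite {m : ℕ} {η : (Fin m → ℤ) →+ ℝ} (s : Set (NovExp η)) : Prop :=
  ∀ C : ℝ, {a | a ∈ s ∧ C ≤ a.height}.Finite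

theorem NovFinite.mono {m : ℕ} {η : (Fin m → ℤ) →+ ℝ} {s t : Set (NovExp η)} (hst : s ⊆ t)
    (ht : NovFinite t) : NovFinite s :=
  fun C => (ht C).subset fun _ ha => ⟨hst ha.1, ha.2⟩

theorem NovFinite.union {m : ℕ} {η : (Fin m → ℤ) →+ ℝ} {s t : Set (NovExp η)}
    (hs : NovFinite s) (ht : NovFinite t) : NovFinite (s ∪ t) := by
  intro C
  refine ((hs C).union (ht C)).subset ?_
  rintro a ⟨ha | ha, hC⟩
  · exact Or.inl ⟨ha, hC⟩
  · exact Or.inr ⟨ha, hC⟩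

theorem NovFinite.of_finite {m : ℕ} {η : (Fin m → ℤ) →+ ℝ} {s : Set (NovExp η)}
    (hs : s.Finite) : NovFinite s :=
  fun _ => hs.subset fun _ ha => ha.1

theorem NovFinite.bddAbove {m : ℕ} {η : (Fin m → ℤ) →+ ℝ} {s : Set (NovExp η)}
    (hs : NovFinite s) : ∃ M : ℝ, ∀ a ∈ s, a.height ≤ M := by
  obtain ⟨M, hM⟩ := ((hs 0).image NovExp.height).bddAbove
  refine ⟨max M 0, fun a ha => ?_⟩
  by_cases h : 0 ≤ a.height
  · exact (hM ⟨a, ⟨ha, h⟩, rfl⟩).trans (le_max_left _ _)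
  · exact (not_le.mp h).le.trans (le_max_right _ _)

open scoped Pointwise in
theorem NovFinite.add {m : ℕ} {η : (Fin m → ℤ) →+ ℝ} {s t : Set (NovExp η)}
    (hs : NovFinite s) (ht : NovFinite t) : NovFinite (s + t) := by
  intro C
  obtain ⟨M, hM⟩ := hs.bddAbove
  obtain ⟨N, hN⟩ := ht.bddAbove
  refine ((hs (C - N)).add (ht (C - M))).subset ?_
  rintro _ ⟨⟨a, ha, b, hb, rfl⟩, hC⟩
  simp only [map_add] at hC
  exact ⟨a, ⟨ha, by linarith [hN b hb]⟩, b, ⟨hb, by linarith [hM a ha]⟩, rfl⟩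

theorem NovFinite.isPWO {m : ℕ} {η : (Fin m → ℤ) →+ ℝ} {s : Set (NovExp η)}
    (hs : NovFinite s) : s.IsPWO := by
  refine Set.partiallyWellOrderedOn_iff_exists_lt.mpr fun f hf => ?_
  by_cases h : ∃ n, 0 < n ∧ (f n).height < (f 0).height
  · obtain ⟨n, hn, hlt⟩ := h
    exact ⟨0, n, hn, Or.inr hlt⟩
  · push Not at h
    have hfin := hs (f 0).height
    have hmem : ∀ n, f n ∈ {a | a ∈ s ∧ (f 0).height ≤ a.height} := by
      intro n
      refine ⟨hf n, ?_⟩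
      rcases Nat.eq_zero_or_pos n with rfl | hn
      · exact le_rfl
      · exact h n hn
    obtain ⟨a, b, hab, he⟩ := hfin.exists_lt_map_eq_of_forall_mem hmem
    exact ⟨a, b, hab, Or.inl he⟩

/-- The Novikov completion of `L_m = R[ℤ^m]` with respect to `η`: the formal series
`∑ n_a a` (`a ∈ ℤ^m`, `n_a ∈ R`) such that for every real `C` only finitely many `a` in the support
have `η a ≥ C`, with the convolution product. The finiteness condition implies that the support is
partially well ordered for the order of `NovExp η`, so that all these series occur among the Hahn
series, whose product is the convolution product. -/
def NovikovRing (R : Type*) [CommRing R] {m : ℕ} (η : (Fin m → ℤ) →+ ℝ) :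
    Subring (HahnSeries (NovExp η) R) where
  carrier := {f | NovFinite f.support}
  mul_mem' hf hg := (hf.add hg).mono HahnSeries.support_mul_subset
  one_mem' := NovFinite.of_finite ((Set.finite_singleton 0).subset HahnSeries.support_single_subset)
  add_mem' hf hg := (hf.union hg).mono (HahnSeries.support_add_subset _ _)
  zero_mem' := NovFinite.of_finite (by simp)
  neg_mem' hf := hf.mono (HahnSeries.support_neg_subset _)

/-- The series with the given coefficients. -/
def NovikovRing.ofFun {R : Type*} [CommRing R] {m : ℕ} {η : (Fin m → ℤ) →+ ℝ} (f : NovExp η → R)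
    (hf : NovFinite (Function.support f)) : NovikovRing R η :=
  ⟨⟨f, hf.isPWO⟩, hf⟩

/-- The monomial `r a`. -/
def NovikovRing.monomial {R : Type*} [CommRing R] {m : ℕ} {η : (Fin m → ℤ) →+ ℝ} (a : NovExp η)
    (r : R) : NovikovRing R η :=
  ⟨HahnSeries.single a r,
    NovFinite.of_finite ((Set.finite_singleton a).subset HahnSeries.support_single_subset)⟩

/-- The inclusion of the ring of Laurent polynomials into its Novikov completion. -/
def laurentToNovikov (R : Type*) [CommRing R] {m : ℕ} (η : (Fin m → ℤ) →+ ℝ) :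
    Laurent R m →+* NovikovRing R η :=
  AddMonoidAlgebra.liftNCRingHom
    ({ toFun := fun r => NovikovRing.monomial 0 r
       map_one' := rfl
       map_zero' := by ext1; simp [NovikovRing.monomial]
       map_add' := fun r s => by ext1; simp [NovikovRing.monomial]
       map_mul' := fun r s => by ext1; simp [NovikovRing.monomial] } : R →+* NovikovRing R η)
    ({ toFun := fun a => NovikovRing.monomial (η := η) a.toAdd 1
       map_one' := rfl
       map_mul' := fun a b => by
         ext1
         refine Eq.trans ?_ HahnSeries.single_mul_single.symm
         rw [mul_one]
         rfl } :
      Multiplicative (Fin m → ℤ) →* NovikovRing R η)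
    (fun _ _ => Commute.all _ _)

end Deformations

/-! ## The Betti numbers of the Laurent and Novikov complexes -/

section Numbers

open Topology

variable {X : Type*} [TopologicalSpace X]

/-- The group `H_1(X, ℤ)/Tors`, where `H_1(X, ℤ)` is the abelianized fundamental group. -/
abbrev H1Free (x₀ : X) : Type _ :=
  Abelianization (FundamentalGroup X x₀) ⧸
    CommGroup.torsion (Abelianization (FundamentalGroup X x₀))

/-- The projection `φ : G → H_1(X, ℤ)/Tors ≅ ℤ^n`. -/
def freeProj {x₀ : X} {n : ℕ} (θ : H1Free x₀ ≃* Multiplicative (Fin n → ℤ)) :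
    FundamentalGroup X x₀ →* Multiplicative (Fin n → ℤ) :=
  θ.toMonoidHom.comp ((QuotientGroup.mk' _).comp Abelianization.of)

/-- The irrationality degree of a class `α ∈ H^1(X, ℂ) = Hom(G, ℂ)`: the rank of the group of its
values. -/
def irr {G : Type*} [Group G] (α : Additive G →+ ℂ) : ℕ := Module.finrank ℤ α.range

variable [CWComplex (Set.univ : Set X)] {x₀ : X} {R : Type*} [CommRing R] {l n m : ℕ}

/-- The representation `ρ_p = ρ ⊗ (p ∘ φ)` over `L_m`. -/
def repP (ρ : FundamentalGroup X x₀ →* GL (Fin l) R)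
    (θ : H1Free x₀ ≃* Multiplicative (Fin n → ℤ)) (p : (Fin n → ℤ) →+ (Fin m → ℤ)) :
    FundamentalGroup X x₀ →* GL (Fin l) (Laurent R m) :=
  laurentRep ρ (p.toMultiplicative.comp (freeProj θ))

/-- The number `b_k(X, ρ; p)`: the dimension over the field of fractions `{L_m}` of
`H_k(C_*(X̃) ⊗_{ρ_p} {L_m}^l)`. -/
def bettiLaurent (ρ : FundamentalGroup X x₀ →* GL (Fin l) R)
    (θ : H1Free x₀ ≃* Multiplicative (Fin n → ℤ)) (p : (Fin n → ℤ) →+ (Fin m → ℤ)) (k : ℕ) : ℕ :=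
  Module.finrank (FractionRing (Laurent R m))
    (TwHomology ((Matrix.GeneralLinearGroup.map
      (algebraMap (Laurent R m) (FractionRing (Laurent R m)))).comp (repP ρ θ p)) k)

/-- The twisted Novikov Betti number: the rank of the module `H_k(C_*(X̃) ⊗_{ρ_p} L̂^l)` over the
Novikov completion `L̂` of `L_m` with respect to `η`. -/
def novikovBetti (ρ : FundamentalGroup X x₀ →* GL (Fin l) R)
    (θ : H1Free x₀ ≃* Multiplicative (Fin n → ℤ)) (p : (Fin n → ℤ) →+ (Fin m → ℤ))
    (η : (Fin m → ℤ) →+ ℝ) (k : ℕ) : ℕ :=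
  bettiHomology ((Matrix.GeneralLinearGroup.map (laurentToNovikov R η)).comp (repP ρ θ p)) k

end Numbers

end ExpDeform

end

noncomputable section

namespace ExpDeform

/-! ## Ranks of matrices over integral domains -/

section MatrixRank

variable {I J : Type*} [Fintype J]

/-! The action of `G` on the cells of the universal covering is free, so choosing one lift of each
cell gives finite bases of the twisted chain and cochain groups. In these bases the boundary has a
matrix whose entries are integer combinations of entries of the matrices `σ g`, hence a change of
rings `f` simply applies `f` to the matrix (`twMatrix_map`). Each Betti number is determined by the
number of basis elements and the ranks of such matrices (`finrank_twHomology_add`).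

Over a domain, the rank is the size of the largest nonvanishing minor. A ring homomorphism between
domains that does not kill a suitable product of minors therefore preserves the Betti number
(`exists_ne_zero_finrank_twHomology_map_eq`), and an injective one always does. Everything is
compared with `ρ_p` over `L_m`. The maps from `L_m` to its fraction field, to its Novikov completion
and, by `a ↦ e^{t α'(a)}`, to `ℂ[[t]]` are injective. For a complex number `t` the same substitution
turns the product of minors into an exponential sum. It is an entire function, not identically zero
because distinct characters are linearly independent, so its zeros form a closed discrete set.

For cohomology, the coboundary matrix of `σ` is the transpose of the boundary matrix of the
contragredient of `σ`. The contragredient of a deformation of `ρ` along `α` is the deformation of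
the contragredient of `ρ` along `-α`, and `-α` factors through the same `p`. -/

theorem exists_submatrix_cols_rank_eq {K : Type*} [Field K] (A : Matrix I J K) {r : ℕ}
    (hr : A.rank = r) : ∃ c : Fin r → J, (A.submatrix id c).rank = r := by
  rw [Matrix.rank_eq_finrank_span_cols] at hr
  subst hr
  have := Module.Finite.span_of_finite K (Set.finite_range A.col)
  obtain ⟨f, hf, -, hli⟩ := Submodule.exists_fun_fin_finrank_span_eq K (Set.range A.col)
  choose c hc using hf
  refine ⟨c, ?_⟩
  rw [Matrix.rank_eq_finrank_span_cols]
  have h : (A.submatrix id c).col = f := funext fun i => hc i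
  rw [h, finrank_span_eq_card hli, Fintype.card_fin]

/-- The column module over `B` embeds in the column space over the fraction field, whose rank over
`B` equals its dimension over the field. -/
theorem rank_le_rank_map_fractionRing {B : Type*} [CommRing B] [IsDomain B] (A : Matrix I J B) :
    A.rank ≤ (A.map (algebraMap B (FractionRing B))).rank := by
  set K := FractionRing B
  have h1 : Module.finrank K (LinearMap.range (A.map (algebraMap B K)).mulVecLin) =
      Module.finrank B (LinearMap.range (A.map (algebraMap B K)).mulVecLin) :=
    congrArg Cardinal.toNat (IsLocalization.rank_eq K (nonZeroDivisors B) le_rfl)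
  rw [Matrix.rank, Matrix.rank, h1]
  let F : (I → B) →ₗ[B] (I → K) := LinearMap.compLeft (Algebra.linearMap B K) I
  have hF : Function.Injective F := fun v w h => funext fun i =>
    IsFractionRing.injective B K (congrFun h i)
  have hmem (x : I → B) (hx : x ∈ LinearMap.range A.mulVecLin) :
      F x ∈ (LinearMap.range (A.map (algebraMap B K)).mulVecLin).restrictScalars B := by
    obtain ⟨v, rfl⟩ := hx
    exact ⟨algebraMap B K ∘ v, funext fun i => ((algebraMap B K).map_mulVec A v i).symm⟩
  let F' := F.restrict hmem
  have hle := LinearMap.lift_rank_le_of_injective F'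
    (fun x y h => Subtype.ext (hF (congrArg Subtype.val h)))
  -- Finiteness is needed because `Cardinal.toNat` sends infinite cardinals to 0 and is monotone
  -- only below `aleph0`.
  have hlt : Module.rank B (LinearMap.range (A.map (algebraMap B K)).mulVecLin) <
      Cardinal.aleph0 := by
    rw [← IsLocalization.rank_eq K (nonZeroDivisors B) le_rfl]
    exact Module.rank_lt_aleph0 _ _
  have := Cardinal.toNat_le_toNat hle (Cardinal.lift_lt_aleph0.mpr hlt)
  rwa [Cardinal.toNat_lift, Cardinal.toNat_lift] at this

theorem le_rank_of_submatrix_det_ne_zero {B : Type*} [CommRing B] [IsDomain B] (A : Matrix I J B)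
    {r : ℕ} (s : Fin r → I) (c : Fin r → J) (h : (A.submatrix s c).det ≠ 0) : r ≤ A.rank := by
  have := A.rank_submatrix_le s c
  rwa [Matrix.rank_of_det_ne_zero h, Fintype.card_fin] at this

variable [Fintype I]

/-- Independent columns are selected first, then independent rows among these by transposing. The
resulting square matrix has full rank, so a vanishing determinant would contradict rank-nullity. -/
theorem exists_submatrix_det_ne_zero_of_field {K : Type*} [Field K] (A : Matrix I J K) {r : ℕ}
    (hr : A.rank = r) :
    ∃ (s : Fin r → I) (c : Fin r → J), (A.submatrix s c).det ≠ 0 := by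
  obtain ⟨c, hc⟩ := exists_submatrix_cols_rank_eq A hr
  have hT : (A.submatrix id c)ᵀ.rank = r := by rw [Matrix.rank_transpose, hc]
  obtain ⟨s, hs⟩ := exists_submatrix_cols_rank_eq (A.submatrix id c)ᵀ hT
  refine ⟨s, c, fun h0 => ?_⟩
  have hsq : (A.submatrix s c)ᵀ.rank = r := hs
  obtain ⟨v, hv, hv0⟩ := Matrix.exists_mulVec_eq_zero_iff.mpr
    ((Matrix.det_transpose _).trans h0 : (A.submatrix s c)ᵀ.det = 0)
  have hker : (A.submatrix s c)ᵀ.mulVecLin.ker ≠ ⊥ := fun hb => hv <| by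
    have : v ∈ (A.submatrix s c)ᵀ.mulVecLin.ker := hv0
    rwa [hb, Submodule.mem_bot] at this
  have h1 := LinearMap.finrank_range_add_finrank_ker (A.submatrix s c)ᵀ.mulVecLin
  rw [Matrix.rank] at hsq
  rw [hsq, Module.finrank_fin_fun] at h1
  exact hker (Submodule.finrank_eq_zero.mp (by omega))

/-- A nonzero minor over the fraction field is the image of a minor over `B`. The latter bounds the
rank over `B` from below, so both ranks agree and the minor has the right size. -/
theorem exists_submatrix_det_ne_zero {B : Type*} [CommRing B] [IsDomain B] (A : Matrix I J B) :
    ∃ (s : Fin A.rank → I) (c : Fin A.rank → J), (A.submatrix s c).det ≠ 0 := by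
  set K := FractionRing B
  obtain ⟨s, c, h⟩ := exists_submatrix_det_ne_zero_of_field (A.map (algebraMap B K)) rfl
  have hle : A.rank ≤ (A.map (algebraMap B K)).rank := rank_le_rank_map_fractionRing A
  have h' : (A.submatrix s c).det ≠ 0 := fun h0 => h <| by
    rw [Matrix.submatrix_map, ← RingHom.mapMatrix_apply, ← RingHom.map_det, h0, map_zero]
  have hrank : (A.map (algebraMap B K)).rank ≤ A.rank := by
    have := A.rank_submatrix_le s c
    rwa [Matrix.rank_of_det_ne_zero h', Fintype.card_fin] at this
  have heq := le_antisymm hle hrank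
  refine ⟨s ∘ Fin.cast heq, c ∘ Fin.cast heq, ?_⟩
  rw [← Matrix.submatrix_submatrix]
  have := Matrix.det_submatrix_equiv_self (finCongr heq) (A.submatrix s c)
  exact fun h0 => h' (this.symm.trans h0)

/-- A minor that is nonzero after applying `f` was nonzero before. -/
theorem rank_map_le {B C : Type*} [CommRing B] [IsDomain B] [CommRing C] [IsDomain C]
    (f : B →+* C) (A : Matrix I J B) : (A.map f).rank ≤ A.rank := by
  obtain ⟨s, c, h⟩ := exists_submatrix_det_ne_zero (A.map f)
  refine le_rank_of_submatrix_det_ne_zero A s c fun h0 => h ?_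
  rw [Matrix.submatrix_map, ← RingHom.mapMatrix_apply, ← RingHom.map_det, h0, map_zero]

/-- Every matrix has a minor whose nonvanishing under a ring homomorphism ensures that the rank is
preserved. -/
theorem exists_ne_zero_rank_map_eq {B : Type*} [CommRing B] [IsDomain B] (A : Matrix I J B) :
    ∃ b : B, b ≠ 0 ∧ ∀ {C : Type*} [CommRing C] [IsDomain C] (f : B →+* C), f b ≠ 0 →
      (A.map f).rank = A.rank := by
  obtain ⟨s, c, h⟩ := exists_submatrix_det_ne_zero A
  refine ⟨_, h, fun f hf => le_antisymm (rank_map_le f A) ?_⟩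
  refine le_rank_of_submatrix_det_ne_zero _ s c ?_
  rwa [Matrix.submatrix_map, ← RingHom.mapMatrix_apply, ← RingHom.map_det]

theorem rank_map_of_injective {B C : Type*} [CommRing B] [IsDomain B] [CommRing C] [IsDomain C]
    (f : B →+* C) (hf : Function.Injective f) (A : Matrix I J B) : (A.map f).rank = A.rank := by
  obtain ⟨b, hb, h⟩ := exists_ne_zero_rank_map_eq A
  exact h f ((map_ne_zero_iff f hf).mpr hb)

theorem rank_transpose_of_isDomain {B : Type*} [CommRing B] [IsDomain B] (A : Matrix I J B) :
    Aᵀ.rank = A.rank := by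
  have hf := IsFractionRing.injective B (FractionRing B)
  rw [← rank_map_of_injective _ hf A, ← rank_map_of_injective _ hf Aᵀ, ← Matrix.rank_transpose]
  rfl

end MatrixRank

/-! ## Ranks of homology modules over integral domains -/

section HomologyRank

universe u v

variable {B : Type v} [CommRing B] [IsDomain B]

/-- Finite rank, rather than finite generation, is the assumption here: it passes to submodules
without any Noetherian condition on `B`. -/
theorem finrank_quotient_add_finrank_of_rank_lt {V : Type u} [AddCommGroup V] [Module B V]
    (hV : Module.rank B V < Cardinal.aleph0) (N : Submodule B V) :
    Module.finrank B (V ⧸ N) + Module.finrank B N = Module.finrank B V := by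
  have h := Submodule.rank_quotient_add_rank N
  rw [Module.finrank, Module.finrank, Module.finrank, ← h, Cardinal.toNat_add]
  · exact (self_le_add_right _ _).trans_lt (h ▸ hV)
  · exact (self_le_add_left _ _).trans_lt (h ▸ hV)

theorem finrank_range_add_finrank_ker_of_rank_lt {V W : Type u} [AddCommGroup V] [Module B V]
    [AddCommGroup W] [Module B W] (hV : Module.rank B V < Cardinal.aleph0) (f : V →ₗ[B] W) :
    Module.finrank B (LinearMap.range f) + Module.finrank B (LinearMap.ker f) =
      Module.finrank B V := by
  rw [← finrank_quotient_add_finrank_of_rank_lt hV (LinearMap.ker f),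
    f.quotKerEquivRange.finrank_eq]

/-- Rank-nullity for `f` and for `f` restricted to the range of `g`, whose kernel is the
intersection of that range with `ker f`. The composite `f ∘ₗ g` need not vanish: its rank is a
correction term, so the cellular identity `∂ ∘ ∂ = 0` does not have to be established. -/
theorem finrank_homology_add {U V W : Type u} [AddCommGroup U] [Module B U] [AddCommGroup V]
    [Module B V] [AddCommGroup W] [Module B W] (hV : Module.rank B V < Cardinal.aleph0)
    (g : U →ₗ[B] V) (f : V →ₗ[B] W) :
    Module.finrank B
        (LinearMap.ker f ⧸ (LinearMap.range g).comap (LinearMap.ker f).subtype) +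
      Module.finrank B (LinearMap.range f) + Module.finrank B (LinearMap.range g) =
    Module.finrank B V + Module.finrank B (LinearMap.range (f ∘ₗ g)) := by
  have h1 := finrank_range_add_finrank_ker_of_rank_lt hV f
  have h2 := finrank_quotient_add_finrank_of_rank_lt
    ((Submodule.rank_le (LinearMap.ker f)).trans_lt hV)
    ((LinearMap.range g).comap (LinearMap.ker f).subtype)
  have h3 := finrank_range_add_finrank_ker_of_rank_lt
    ((Submodule.rank_le (LinearMap.range g)).trans_lt hV) (f.domRestrict (LinearMap.range g))
  have h4 : LinearMap.range (f.domRestrict (LinearMap.range g)) = LinearMap.range (f ∘ₗ g) := by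
    ext w
    simp [LinearMap.mem_range]
  have h5 : Module.finrank B (LinearMap.ker (f.domRestrict (LinearMap.range g))) =
      Module.finrank B ((LinearMap.range g).comap (LinearMap.ker f).subtype) := by
    rw [← Submodule.finrank_map_subtype_eq, ← Submodule.finrank_map_subtype_eq (LinearMap.ker f)]
    have : (LinearMap.ker (f.domRestrict (LinearMap.range g))).map (LinearMap.range g).subtype =
        ((LinearMap.range g).comap (LinearMap.ker f).subtype).map (LinearMap.ker f).subtype := by
      ext x
      simp [LinearMap.mem_ker, and_comm]
    rw [this]
  rw [h4, h5] at h3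
  omega

end HomologyRank

/-! ## Bases of the cellular chain groups of the universal covering -/

section Cells

open Topology

variable {X : Type*} [TopologicalSpace X]

theorem symm_trans_symm {x y z : X} (p : Path.Homotopic.Quotient x y)
    (q : Path.Homotopic.Quotient y z) : (p.trans q).symm = q.symm.trans p.symm := by
  induction p using Path.Homotopic.Quotient.ind with
  | mk p =>
    induction q using Path.Homotopic.Quotient.ind with
    | mk q =>
      simp only [← Path.Homotopic.Quotient.mk_symm, ← Path.Homotopic.Quotient.mk_trans,
        Path.trans_symm]

theorem symm_symm_quotient {x y : X} (p : Path.Homotopic.Quotient x y) : p.symm.symm = p := by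
  induction p using Path.Homotopic.Quotient.ind with
  | mk p => simp only [← Path.Homotopic.Quotient.mk_symm, Path.symm_symm]

theorem trans_symm_symm_trans {x y z w : X} (p : Path.Homotopic.Quotient x y)
    (q : Path.Homotopic.Quotient z y) (h : Path.Homotopic.Quotient z w) :
    p.trans (h.symm.trans q).symm = (p.trans q.symm).trans h := by
  rw [symm_trans_symm, symm_symm_quotient, Path.Homotopic.Quotient.trans_assoc]

theorem trans_symm_symm_trans_self {x y z : X} (p : Path.Homotopic.Quotient x y)
    (q : Path.Homotopic.Quotient z y) : (p.trans q.symm).symm.trans p = q := by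
  rw [symm_trans_symm, symm_symm_quotient, Path.Homotopic.Quotient.trans_assoc,
    Path.Homotopic.Quotient.symm_trans, Path.Homotopic.Quotient.trans_refl]

variable [CWComplex (Set.univ : Set X)] {x₀ : X} {k : ℕ}

/-- The cells of `X` that have a lift to `X̃`. -/
abbrev BaseCell (x₀ : X) (k : ℕ) : Type _ :=
  {i : XCell X k // Nonempty (Path.Homotopic.Quotient x₀ (cellCenter i))}

instance [RelCWComplex.Finite (Set.univ : Set X)] : Finite (BaseCell x₀ k) :=
  have : Finite (XCell X k) := RelCWComplex.FiniteType.finite_cell k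
  Subtype.finite

/-- A chosen lift of a cell. -/
def BaseCell.lift (i : BaseCell x₀ k) : LiftedCell x₀ k := ⟨i.1, i.2.some⟩

/-- The projection of a cell of `X̃` to `X`. -/
def LiftedCell.base (e : LiftedCell x₀ k) : BaseCell x₀ k := ⟨e.1, ⟨e.2⟩⟩

/-- The deck transformation that takes the chosen lift to the given one. -/
def LiftedCell.shift (e : LiftedCell x₀ k) : FundamentalGroup X x₀ :=
  FundamentalGroup.fromPath (e.base.2.some.trans e.2.symm)

theorem LiftedCell.base_smul (g : FundamentalGroup X x₀) (e : LiftedCell x₀ k) :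
    (g • e).base = e.base := rfl

/-- Together with `LiftedCell.shift_smul_lift` this says that the chosen lifts form a basis of the
free `G`-set of cells. -/
theorem LiftedCell.shift_smul (g : FundamentalGroup X x₀) (e : LiftedCell x₀ k) :
    (g • e).shift = g * e.shift :=
  trans_symm_symm_trans e.base.2.some e.2 (FundamentalGroup.toPath g)

theorem BaseCell.shift_lift (i : BaseCell x₀ k) : i.lift.shift = 1 :=
  Path.Homotopic.Quotient.trans_symm _

theorem LiftedCell.shift_smul_lift (e : LiftedCell x₀ k) : e.shift • e.base.lift = e :=
  Sigma.ext rfl (heq_of_eq (trans_symm_symm_trans_self e.base.2.some e.2))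

theorem deck_single (g : FundamentalGroup X x₀) (e : LiftedCell x₀ k) (n : ℤ) :
    deck g (Finsupp.single e n) = Finsupp.single (g • e) n := by
  simp [deck]

end Cells

/-! ### Freeness of the twisted chain groups and the matrix of the boundary operator -/

section Matrices

open Topology

variable {X : Type*} [TopologicalSpace X] [CWComplex (Set.univ : Set X)] {x₀ : X}
variable {B : Type*} [CommRing B] {l : ℕ}

/-- The operator by which a cell of `X̃` acts on the coordinates at its projection. -/
def shiftMatrix (σ : FundamentalGroup X x₀ →* GL (Fin l) B) {k : ℕ} (e : LiftedCell x₀ k) :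
    Matrix (Fin l) (Fin l) B := (σ e.shift⁻¹).1

theorem shiftMatrix_lift (σ : FundamentalGroup X x₀ →* GL (Fin l) B) {k : ℕ}
    (i : BaseCell x₀ k) : shiftMatrix σ i.lift = 1 := by
  rw [shiftMatrix, BaseCell.shift_lift, inv_one, map_one, Units.val_one]

open Classical in
/-- The matrix block of a chain at a cell, for twisted coefficients. -/
def chainBlock (σ : FundamentalGroup X x₀ →* GL (Fin l) B) {k : ℕ} (c : Chains x₀ k)
    (i : BaseCell x₀ k) : Matrix (Fin l) (Fin l) B :=
  c.sum fun e n => if e.base = i then n • shiftMatrix σ e else 0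

/-- The matrix of the boundary operator of the twisted chain complex. -/
def twMatrix (σ : FundamentalGroup X x₀ →* GL (Fin l) B) (k : ℕ) :
    Matrix (Σ _ : BaseCell x₀ (k - 1), Fin l) (Σ _ : BaseCell x₀ k, Fin l) B :=
  fun u v => chainBlock σ (boundary x₀ k (Finsupp.single v.1.lift 1)) u.1 u.2 v.2

/-- The boundary of a lifted cell has integer coefficients independent of `σ`; only the factors
`shiftMatrix σ e` involve the coefficient ring, and `f` acts on them entrywise. -/
theorem twMatrix_map {C : Type*} [CommRing C] (f : B →+* C)
    (σ : FundamentalGroup X x₀ →* GL (Fin l) B) (k : ℕ) :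
    twMatrix ((Matrix.GeneralLinearGroup.map f).comp σ) k = (twMatrix σ k).map f := by
  classical
  ext u v
  simp only [twMatrix, chainBlock, Matrix.map_apply, Finsupp.sum, Matrix.sum_apply, map_sum]
  refine Finset.sum_congr rfl fun e _ => ?_
  split_ifs <;> simp [shiftMatrix, -map_inv]

open Classical in
/-- The coordinates of a twisted chain, before passing to the quotient. -/
def preCoord (σ : FundamentalGroup X x₀ →* GL (Fin l) B) (k : ℕ) :
    (Fin l → B) ⊗[ℤ] Chains x₀ k →ₗ[B] (BaseCell x₀ k → Fin l → B) :=
  (Finsupp.lsum B fun e : LiftedCell x₀ k =>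
    LinearMap.single B (fun _ => Fin l → B) e.base ∘ₗ (shiftMatrix σ e).mulVecLin) ∘ₗ
  (TensorProduct.finsuppScalarRight ℤ B (Fin l → B) (LiftedCell x₀ k)).toLinearMap

open Classical in
theorem preCoord_tmul_single (σ : FundamentalGroup X x₀ →* GL (Fin l) B) {k : ℕ} (v : Fin l → B)
    (e : LiftedCell x₀ k) (n : ℤ) :
    preCoord σ k (v ⊗ₜ[ℤ] Finsupp.single e n) =
      n • Pi.single e.base (shiftMatrix σ e *ᵥ v) := by
  simp only [preCoord, LinearMap.comp_apply, LinearEquiv.coe_coe,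
    TensorProduct.finsuppScalarRight_apply_tmul, Finsupp.sum_single_index, zero_smul,
    Finsupp.single_zero]
  rw [Finsupp.lsum_single, map_zsmul]
  rfl

theorem preCoord_tmul (σ : FundamentalGroup X x₀ →* GL (Fin l) B) {k : ℕ} (v : Fin l → B)
    (c : Chains x₀ k) (i : BaseCell x₀ k) :
    preCoord σ k (v ⊗ₜ[ℤ] c) i = chainBlock σ c i *ᵥ v := by
  classical
  induction c using Finsupp.induction_linear with
  | zero => simp [chainBlock]
  | add c d hc hd =>
    rw [TensorProduct.tmul_add, map_add, Pi.add_apply, hc, hd, ← Matrix.add_mulVec]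
    congr 1
    simp only [chainBlock]
    rw [Finsupp.sum_add_index']
    · simp
    · intro e m n
      split_ifs <;> simp [add_smul]
  | single e n =>
    rw [preCoord_tmul_single, chainBlock, Finsupp.sum_single_index (by simp)]
    split_ifs with h
    · subst h
      rw [Pi.smul_apply, Pi.single_eq_same, Matrix.smul_mulVec]
    · simp [Ne.symm h]

/-- For a single cell both terms have the same projection, and the inverse of the shift of `g⁻¹ • e`
is `e.shift⁻¹ * g`, which accounts for the factor `σ g`. -/
theorem tensorRelations_le_ker (σ : FundamentalGroup X x₀ →* GL (Fin l) B) (k : ℕ) :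
    tensorRelations σ k ≤ LinearMap.ker (preCoord σ k) := by
  classical
  rw [tensorRelations, Submodule.span_le]
  rintro _ ⟨g, v, x, rfl⟩
  rw [SetLike.mem_coe, LinearMap.mem_ker, map_sub, sub_eq_zero]
  induction x using Finsupp.induction_linear with
  | zero => simp
  | add c d hc hd => simp only [map_add, TensorProduct.tmul_add, hc, hd]
  | single e n =>
    rw [deck_single, preCoord_tmul_single, preCoord_tmul_single, LiftedCell.base_smul,
      shiftMatrix, LiftedCell.shift_smul, mul_inv_rev, inv_inv, map_mul, shiftMatrix,
      Units.val_mul, Matrix.mulVec_mulVec]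

/-- The defining relation for `g = e.shift⁻¹` moves any cell to the chosen lift below it, so the
chosen lifts generate the quotient. -/
theorem mk_tmul_single (σ : FundamentalGroup X x₀ →* GL (Fin l) B) {k : ℕ} (v : Fin l → B)
    (e : LiftedCell x₀ k) (n : ℤ) :
    (tensorRelations σ k).mkQ (v ⊗ₜ[ℤ] Finsupp.single e n) =
      (tensorRelations σ k).mkQ
        ((shiftMatrix σ e *ᵥ v) ⊗ₜ[ℤ] Finsupp.single e.base.lift n) := by
  refine (Submodule.Quotient.eq _).mpr (Submodule.subset_span ⟨e.shift⁻¹, v, Finsupp.single e.base.lift n, ?_⟩)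
  rw [deck_single, inv_inv, shiftMatrix, LiftedCell.shift_smul_lift]

variable [RelCWComplex.Finite (Set.univ : Set X)]

instance (k : ℕ) : Fintype (BaseCell x₀ k) := Fintype.ofFinite _

open Classical in
/-- The twisted chain groups are free. -/
def twChainsEquiv (σ : FundamentalGroup X x₀ →* GL (Fin l) B) (k : ℕ) :
    TwChains σ k ≃ₗ[B] (BaseCell x₀ k → Fin l → B) :=
  LinearEquiv.ofLinearMap
    ((tensorRelations σ k).liftQ (preCoord σ k) (tensorRelations_le_ker σ k))
    (LinearMap.lsum B (fun _ => Fin l → B) B fun i => (tensorRelations σ k).mkQ ∘ₗ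
      (TensorProduct.AlgebraTensorModule.mk ℤ B (Fin l → B) (Chains x₀ k)).flip
        (Finsupp.single i.lift 1))
    (by
      refine LinearMap.pi_ext fun i v => ?_
      rw [LinearMap.comp_apply, LinearMap.lsum_piSingle]
      change preCoord σ k (v ⊗ₜ[ℤ] Finsupp.single i.lift 1) = _
      rw [preCoord_tmul_single, shiftMatrix_lift, one_smul, Matrix.one_mulVec]
      rfl)
    (by
      refine Submodule.linearMap_qext _ (LinearMap.ext fun z => ?_)
      induction z using TensorProduct.induction_on with
      | zero => simp only [map_zero]
      | add y z hy hz => simp only [map_add, hy, hz]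
      | tmul v c =>
        induction c using Finsupp.induction_linear with
        | zero => simp only [TensorProduct.tmul_zero, map_zero]
        | add c d hc hd => simp only [TensorProduct.tmul_add, map_add, hc, hd]
        | single e n =>
          change LinearMap.lsum B (fun _ => Fin l → B) B _ (preCoord σ k _) =
            (tensorRelations σ k).mkQ _
          rw [preCoord_tmul_single, map_zsmul, LinearMap.lsum_piSingle, mk_tmul_single]
          change n • (tensorRelations σ k).mkQ (_ ⊗ₜ[ℤ] _) = _
          rw [← map_zsmul, ← TensorProduct.tmul_smul, Finsupp.smul_single, smul_eq_mul, mul_one])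

theorem twChainsEquiv_mkQ (σ : FundamentalGroup X x₀ →* GL (Fin l) B) {k : ℕ} (v : Fin l → B)
    (c : Chains x₀ k) (i : BaseCell x₀ k) :
    twChainsEquiv σ k ((tensorRelations σ k).mkQ (v ⊗ₜ[ℤ] c)) i = chainBlock σ c i *ᵥ v :=
  preCoord_tmul σ v c i

open Classical in
theorem twChainsEquiv_symm_single (σ : FundamentalGroup X x₀ →* GL (Fin l) B) {k : ℕ}
    (i : BaseCell x₀ k) (v : Fin l → B) :
    (twChainsEquiv σ k).symm (Pi.single i v) =
      (tensorRelations σ k).mkQ (v ⊗ₜ[ℤ] Finsupp.single i.lift 1) := by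
  change LinearMap.lsum B (fun _ => Fin l → B) B _ _ = _
  rw [LinearMap.lsum_piSingle]
  rfl

/-- The basis of the twisted chain group given by the chosen lifts. -/
def twBasis (σ : FundamentalGroup X x₀ →* GL (Fin l) B) (k : ℕ) :
    Module.Basis (Σ _ : BaseCell x₀ k, Fin l) B (TwChains σ k) :=
  (Pi.basis fun _ => Pi.basisFun B (Fin l)).map (twChainsEquiv σ k).symm

open Classical in
theorem toMatrix_twBoundary (σ : FundamentalGroup X x₀ →* GL (Fin l) B) (k : ℕ) :
    LinearMap.toMatrix (twBasis σ k) (twBasis σ (k - 1)) (twBoundary σ k) = twMatrix σ k := by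
  ext u v
  rw [LinearMap.toMatrix_apply]
  simp only [twBasis, Module.Basis.map_apply, Pi.basis_apply, Pi.basisFun_apply,
    twChainsEquiv_symm_single, Module.Basis.map_repr, LinearEquiv.trans_apply,
    LinearEquiv.symm_symm, Pi.basis_repr, Pi.basisFun_repr]
  change twChainsEquiv σ (k - 1) ((tensorRelations σ (k - 1)).mkQ
    (Pi.single v.2 1 ⊗ₜ[ℤ] boundary x₀ k (Finsupp.single v.1.lift 1))) u.1 u.2 = _
  rw [twChainsEquiv_mkQ, Matrix.mulVec_single_one]
  rfl

end Matrices

/-! ### Twisted cochains, duality and the rank formula for Betti numbers -/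

section Betti

open Topology

variable {X : Type*} [TopologicalSpace X] [CWComplex (Set.univ : Set X)] {x₀ : X}
variable {B : Type*} [CommRing B] {l : ℕ}

open Classical in
/-- The twisted cochain with given values on the chosen lifts. -/
def cochainOfValues (σ : FundamentalGroup X x₀ →* GL (Fin l) B) {k : ℕ}
    (w : BaseCell x₀ k → Fin l → B) : TwCochains σ k :=
  ⟨Finsupp.linearCombination ℤ fun e : LiftedCell x₀ k => (σ e.shift).1 *ᵥ w e.base, by
    intro g x
    induction x using Finsupp.induction_linear with
    | zero => simp
    | add c d hc hd => simp only [map_add, hc, hd, Matrix.mulVec_add]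
    | single e n =>
      rw [deck_single, Finsupp.linearCombination_single, Finsupp.linearCombination_single,
        LiftedCell.base_smul, LiftedCell.shift_smul, map_mul, Units.val_mul,
        ← Matrix.mulVec_mulVec, Matrix.mulVec_smul]⟩

/-- The twisted cochain groups are free. -/
def twCochainsEquiv (σ : FundamentalGroup X x₀ →* GL (Fin l) B) (k : ℕ) :
    TwCochains σ k ≃ₗ[B] (BaseCell x₀ k → Fin l → B) where
  toFun c i := c.1 (Finsupp.single i.lift 1)
  map_add' _ _ := rfl
  map_smul' _ _ := rfl
  invFun := cochainOfValues σ
  left_inv c := by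
    refine Subtype.ext (Finsupp.lhom_ext fun e n => ?_)
    -- Equivariance under `e.shift` recovers the value at `e` from the value at the chosen lift.
    have h := c.2 e.shift (Finsupp.single e.base.lift n)
    rw [deck_single, LiftedCell.shift_smul_lift] at h
    rw [h, cochainOfValues, Finsupp.linearCombination_single, ← Matrix.mulVec_smul, ← map_zsmul,
      Finsupp.smul_single, smul_eq_mul, mul_one]
  right_inv w := by
    funext i
    simp only [cochainOfValues]
    rw [Finsupp.linearCombination_single, one_smul, BaseCell.shift_lift, map_one, Units.val_one,
      Matrix.one_mulVec]
    rfl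

/-- The source of duality: the contragredient at `e.shift⁻¹` is the transpose of `σ e.shift`, so
evaluating a basis cochain on a chain reads off a transposed entry of the contragredient block. -/
theorem cochainOfValues_apply (σ : FundamentalGroup X x₀ →* GL (Fin l) B) {k : ℕ}
    [DecidableEq (BaseCell x₀ k)] (i : BaseCell x₀ k) (a b : Fin l) (c : Chains x₀ k) :
    (cochainOfValues σ (Pi.single i (Pi.single a 1))).1 c b =
      chainBlock (contragredient σ) c i a b := by
  simp only [cochainOfValues, chainBlock, Finsupp.linearCombination_apply, Finsupp.sum,
    Finset.sum_apply, Matrix.sum_apply]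
  refine Finset.sum_congr rfl fun e _ => ?_
  have h : (shiftMatrix (contragredient σ) e) = (σ e.shift).1ᵀ := by
    simp [shiftMatrix, contragredient, -Matrix.coe_units_inv]
  rw [h]
  split_ifs with h
  · subst h
    simp
  · simp [h]

/-- The matrix of the boundary operator of degree `k + 1`. -/
abbrev twMatrixSucc (σ : FundamentalGroup X x₀ →* GL (Fin l) B) (k : ℕ) :
    Matrix (Σ _ : BaseCell x₀ k, Fin l) (Σ _ : BaseCell x₀ (k + 1), Fin l) B :=
  twMatrix σ (k + 1)

theorem twMatrixSucc_map {C : Type*} [CommRing C] (f : B →+* C)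
    (σ : FundamentalGroup X x₀ →* GL (Fin l) B) (k : ℕ) :
    twMatrixSucc ((Matrix.GeneralLinearGroup.map f).comp σ) k = (twMatrixSucc σ k).map f :=
  twMatrix_map f σ (k + 1)

variable [RelCWComplex.Finite (Set.univ : Set X)]

/-- The basis of the twisted cochain group given by the chosen lifts. -/
def twCoBasis (σ : FundamentalGroup X x₀ →* GL (Fin l) B) (k : ℕ) :
    Module.Basis (Σ _ : BaseCell x₀ k, Fin l) B (TwCochains σ k) :=
  (Pi.basis fun _ => Pi.basisFun B (Fin l)).map (twCochainsEquiv σ k).symm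

open Classical in
theorem toMatrix_twCoboundary (σ : FundamentalGroup X x₀ →* GL (Fin l) B) (k : ℕ) :
    LinearMap.toMatrix (twCoBasis σ (k - 1)) (twCoBasis σ k) (twCoboundary σ k) =
      (twMatrix (contragredient σ) k)ᵀ := by
  ext u v
  rw [LinearMap.toMatrix_apply]
  simp only [twCoBasis, Module.Basis.map_apply, Pi.basis_apply, Pi.basisFun_apply,
    Module.Basis.map_repr, LinearEquiv.trans_apply,
    LinearEquiv.symm_symm, Pi.basis_repr, Pi.basisFun_repr]
  exact cochainOfValues_apply σ v.1 v.2 u.2 (boundary x₀ k (Finsupp.single u.1.lift 1))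

theorem finrank_range_eq_rank_toMatrix {I J V W : Type*} [Fintype I] [Fintype J] [DecidableEq J]
    [AddCommGroup V] [Module B V] [AddCommGroup W] [Module B W]
    (b : Module.Basis J B V) (c : Module.Basis I B W) (f : V →ₗ[B] W) :
    Module.finrank B (LinearMap.range f) = (LinearMap.toMatrix b c f).rank := by
  rw [Matrix.rank_eq_finrank_range_toLin _ c b, Matrix.toLin_toMatrix]

/-- Localization at the non-zero-divisors does not change the rank, so Betti numbers can be computed
over `B` itself. -/
theorem finrank_fractionRing_tensorProduct {M : Type*} [AddCommGroup M] [Module B M] :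
    Module.finrank (FractionRing B) (FractionRing B ⊗[B] M) = Module.finrank B M := by
  have h : Module.finrank (FractionRing B) (FractionRing B ⊗[B] M) =
      Module.finrank B (FractionRing B ⊗[B] M) :=
    congrArg Cardinal.toNat (IsLocalization.rank_eq (FractionRing B) (nonZeroDivisors B) le_rfl)
  rw [h]
  exact IsLocalizedModule.finrank_eq (nonZeroDivisors B) (TensorProduct.mk B (FractionRing B) M 1)
    le_rfl

variable [IsDomain B]

theorem finrank_twHomology_add (σ : FundamentalGroup X x₀ →* GL (Fin l) B) (k : ℕ) :
    Module.finrank B (TwHomology σ k) + (twMatrix σ k).rank + (twMatrixSucc σ k).rank =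
      Fintype.card (Σ _ : BaseCell x₀ k, Fin l) +
        Matrix.rank (twMatrix σ k * twMatrixSucc σ k) := by
  classical
  have hV : Module.rank B (TwChains σ k) < Cardinal.aleph0 := by
    rw [rank_eq_card_basis (twBasis σ k)]
    exact Cardinal.natCast_lt_aleph0
  have h := finrank_homology_add hV (twBoundary σ (k + 1)) (twBoundary σ k)
  have h1 := LinearMap.toMatrix_comp (twBasis σ (k + 1)) (twBasis σ k) (twBasis σ (k - 1))
    (twBoundary σ k) (twBoundary σ (k + 1))
  rw [finrank_range_eq_rank_toMatrix (twBasis σ k) (twBasis σ (k - 1)) (twBoundary σ k),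
    finrank_range_eq_rank_toMatrix (twBasis σ (k + 1)) (twBasis σ k) (twBoundary σ (k + 1)),
    finrank_range_eq_rank_toMatrix (twBasis σ (k + 1)) (twBasis σ (k - 1)), h1,
    toMatrix_twBoundary, Module.finrank_eq_card_basis (twBasis σ k)] at h
  -- The degree `k + 1 - 1` produced by the general formula is definitionally `k`.
  have h2 : LinearMap.toMatrix (twBasis σ (k + 1)) (twBasis σ k) (twBoundary σ (k + 1)) =
    twMatrixSucc σ k := toMatrix_twBoundary σ (k + 1)
  rw [h2] at h
  exact h

/-- Transposing exchanges the roles of the two differentials and preserves all ranks, including that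
of their product, so both sides satisfy the same rank equation. -/
theorem finrank_twCohomology (σ : FundamentalGroup X x₀ →* GL (Fin l) B) (k : ℕ) :
    Module.finrank B (TwCohomology σ k) = Module.finrank B (TwHomology (contragredient σ) k) := by
  classical
  have hV : Module.rank B (TwCochains σ k) < Cardinal.aleph0 := by
    rw [rank_eq_card_basis (twCoBasis σ k)]
    exact Cardinal.natCast_lt_aleph0
  have h := finrank_homology_add (V := TwCochains σ k) hV (twCoboundary σ k)
    (twCoboundary σ (k + 1))
  have h1 := LinearMap.toMatrix_comp (twCoBasis σ (k - 1)) (twCoBasis σ k) (twCoBasis σ (k + 1))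
    (twCoboundary σ (k + 1)) (twCoboundary σ k)
  have h2 : LinearMap.toMatrix (twCoBasis σ k) (twCoBasis σ (k + 1)) (twCoboundary σ (k + 1)) =
    (twMatrixSucc (contragredient σ) k)ᵀ := toMatrix_twCoboundary σ (k + 1)
  rw [finrank_range_eq_rank_toMatrix (twCoBasis σ (k - 1)) (twCoBasis σ k) (twCoboundary σ k),
    finrank_range_eq_rank_toMatrix (twCoBasis σ k) (twCoBasis σ (k + 1)) (twCoboundary σ (k + 1)),
    finrank_range_eq_rank_toMatrix (twCoBasis σ (k - 1)) (twCoBasis σ (k + 1)), h1,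
    toMatrix_twCoboundary, Module.finrank_eq_card_basis (twCoBasis σ k), h2,
    ← Matrix.transpose_mul, rank_transpose_of_isDomain, rank_transpose_of_isDomain,
    rank_transpose_of_isDomain] at h
  have h3 := finrank_twHomology_add (contragredient σ) k
  change Module.finrank B (TwCohomology σ k) + _ + _ = _ at h
  omega

theorem exists_ne_zero_finrank_twHomology_map_eq (σ : FundamentalGroup X x₀ →* GL (Fin l) B)
    (k : ℕ) : ∃ b : B, b ≠ 0 ∧ ∀ {C : Type*} [CommRing C] [IsDomain C] (f : B →+* C), f b ≠ 0 →
      Module.finrank C (TwHomology ((Matrix.GeneralLinearGroup.map f).comp σ) k) =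
        Module.finrank B (TwHomology σ k) := by
  classical
  obtain ⟨b₁, hb₁, h₁⟩ := exists_ne_zero_rank_map_eq (twMatrix σ k)
  obtain ⟨b₂, hb₂, h₂⟩ := exists_ne_zero_rank_map_eq (twMatrixSucc σ k)
  obtain ⟨b₃, hb₃, h₃⟩ := exists_ne_zero_rank_map_eq
    (twMatrix σ k * twMatrixSucc σ k)
  -- One minor each for the two boundary matrices and for their product, the correction term in
  -- `finrank_twHomology_add`.
  refine ⟨b₁ * b₂ * b₃, mul_ne_zero (mul_ne_zero hb₁ hb₂) hb₃, fun f hf => ?_⟩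
  rw [map_mul, map_mul, mul_ne_zero_iff, mul_ne_zero_iff] at hf
  have h := finrank_twHomology_add σ k
  have h' := finrank_twHomology_add ((Matrix.GeneralLinearGroup.map f).comp σ) k
  have h4 := h₃ f hf.2
  rw [Matrix.map_mul] at h4
  rw [twMatrix_map, twMatrixSucc_map, h₁ f hf.1.1, h₂ f hf.1.2, h4] at h'
  omega

theorem finrank_twHomology_map_of_injective {C : Type*} [CommRing C] [IsDomain C] (f : B →+* C)
    (hf : Function.Injective f) (σ : FundamentalGroup X x₀ →* GL (Fin l) B) (k : ℕ) :
    Module.finrank C (TwHomology ((Matrix.GeneralLinearGroup.map f).comp σ) k) =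
      Module.finrank B (TwHomology σ k) := by
  obtain ⟨b, hb, h⟩ := exists_ne_zero_finrank_twHomology_map_eq σ k
  exact h f ((map_ne_zero_iff f hf).mpr hb)

end Betti

/-! ## Characters of `ℤ^m` and specializations of the Laurent representation -/

section Specialize

variable {G : Type*} [Group G] {l m : ℕ}

theorem twist_val {R S : Type*} [CommRing R] [CommRing S] [Algebra R S]
    (ρ : G →* GL (Fin l) R) (χ : G →* Sˣ) (g : G) :
    (twist ρ χ g).1 = (χ g : S) • (ρ g).1.map (algebraMap R S) := by
  ext i j
  simp [twist, Matrix.scalar_apply]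

theorem contragredient_val {R : Type*} [CommRing R] (ρ : G →* GL (Fin l) R) (g : G) :
    (contragredient ρ g).1 = (ρ g⁻¹).1ᵀ := by
  rw [map_inv]
  rfl

theorem map_comp_twist {R S T : Type*} [CommRing R] [CommRing S] [Algebra R S] [CommRing T]
    [Algebra R T] (f : S →ₐ[R] T) (ρ : G →* GL (Fin l) R) (χ : G →* Sˣ) :
    (Matrix.GeneralLinearGroup.map (f : S →+* T)).comp (twist ρ χ) =
      twist ρ ((Units.map (f : S →* T)).comp χ) := by
  refine MonoidHom.ext fun g => Units.ext ?_
  rw [twist_val]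
  change (twist ρ χ g).1.map f = _
  rw [twist_val]
  ext i j
  simp

/-- A scalar is its own transpose, so only the inversion of `g` affects the character. -/
theorem contragredient_twist {R S : Type*} [CommRing R] [CommRing S] [Algebra R S]
    (ρ : G →* GL (Fin l) R) (χ : G →* Sˣ) :
    contragredient (twist ρ χ) = twist (contragredient ρ) χ⁻¹ := by
  refine MonoidHom.ext fun g => Units.ext ?_
  rw [contragredient_val, twist_val, twist_val, contragredient_val, Matrix.transpose_smul,
    Matrix.transpose_map, MonoidHom.inv_apply, map_inv]

theorem contragredient_expDeformation (ρ : G →* GL (Fin l) ℂ) (α : Additive G →+ ℂ) (t : ℂ) :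
    contragredient (expDeformation ρ α t) = expDeformation (contragredient ρ) α (-t) := by
  rw [expDeformation, contragredient_twist, expDeformation]
  congr 1
  refine MonoidHom.ext fun g => ?_
  rw [MonoidHom.inv_apply, ← map_inv]
  refine Units.ext ?_
  change Complex.exp (t * α (Additive.ofMul g⁻¹)) = Complex.exp (-t * α (Additive.ofMul g))
  rw [ofMul_inv, map_neg, mul_neg, neg_mul]

theorem contragredient_formalDeformation (ρ : G →* GL (Fin l) ℂ) (α : Additive G →+ ℂ) :
    contragredient (formalDeformation ρ α) = formalDeformation (contragredient ρ) (-α) := by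
  rw [formalDeformation, contragredient_twist, formalDeformation]
  congr 1
  refine MonoidHom.ext fun g => ?_
  rw [MonoidHom.inv_apply, ← map_inv]
  refine Units.ext ?_
  change formalExp (α (Additive.ofMul g⁻¹)) = formalExp ((-α) (Additive.ofMul g))
  rw [ofMul_inv, map_neg, AddMonoidHom.neg_apply]

/-- The exponential character of `ℤ^m` with parameter `t`. -/
def expEval (β : (Fin m → ℤ) →+ ℂ) (t : ℂ) : Laurent ℂ m →ₐ[ℂ] ℂ :=
  AddMonoidAlgebra.lift ℂ ℂ (Fin m → ℤ)
    { toFun := fun a => Complex.exp (t * β a.toAdd)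
      map_one' := by simp
      map_mul' := fun a b => by simp [mul_add, Complex.exp_add] }

/-- The formal exponential character of `ℤ^m`. -/
def formalEval (β : (Fin m → ℤ) →+ ℂ) : Laurent ℂ m →ₐ[ℂ] PowerSeries ℂ :=
  AddMonoidAlgebra.lift ℂ (PowerSeries ℂ) (Fin m → ℤ)
    { toFun := fun a => formalExp (β a.toAdd)
      map_one' := by
        ext n
        rcases n with _ | n <;> simp [formalExp, PowerSeries.coeff_one]
      map_mul' := fun a b => by
        simp [formalExp, PowerSeries.exp_mul_exp_eq_exp_add] }

theorem expEval_apply (β : (Fin m → ℤ) →+ ℂ) (t : ℂ) (x : Laurent ℂ m) :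
    expEval β t x = ∑ a ∈ x.coeff.support, x.coeff a * Complex.exp (t * β a) := by
  rw [expEval, AddMonoidAlgebra.lift_apply]
  rfl

theorem coeff_formalEval (β : (Fin m → ℤ) →+ ℂ) (x : Laurent ℂ m) (n : ℕ) :
    PowerSeries.coeff n (formalEval β x) =
      (∑ a ∈ x.coeff.support, x.coeff a * β a ^ n) * (n.factorial : ℂ)⁻¹ := by
  rw [formalEval, AddMonoidAlgebra.lift_apply, Finsupp.sum, map_sum, Finset.sum_mul]
  refine Finset.sum_congr rfl fun a _ => ?_
  simp [formalExp, PowerSeries.coeff_rescale, PowerSeries.coeff_exp, mul_assoc]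

/-- Dedekind's independence of characters: the coefficients of `x` are those of a linear relation
among the distinct characters `χ a`. -/
theorem eq_zero_of_sum_monoidHom {M : Type*} [Monoid M] (χ : (Fin m → ℤ) → M →* ℂ)
    (hχ : Function.Injective χ) (x : Laurent ℂ m)
    (h : ∀ s, ∑ a ∈ x.coeff.support, x.coeff a * χ a s = 0) : x = 0 := by
  have hli := (linearIndependent_monoidHom M ℂ).comp χ hχ
  have := linearIndependent_iff.mp hli x.coeff (by
    funext s
    rw [Finsupp.linearCombination_apply, Finsupp.sum, Finset.sum_apply]
    exact h s)
  exact AddMonoidAlgebra.coeff_injective this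

/-- Up to factorials, the coefficients of the image are the power sums of the values `β a`, weighted
by the coefficients of `x`. For distinct values the sequences `n ↦ (β a) ^ n` are independent
characters of the monoid of natural numbers. -/
theorem formalEval_injective {β : (Fin m → ℤ) →+ ℂ} (hβ : Function.Injective β) :
    Function.Injective (formalEval β) := by
  rw [injective_iff_map_eq_zero]
  intro x hx
  refine eq_zero_of_sum_monoidHom (fun a => powersHom ℂ (β a))
    ((powersHom ℂ).injective.comp hβ) x fun s => ?_
  have h := coeff_formalEval β x s.toAdd
  rw [hx, map_zero, eq_comm, mul_eq_zero] at h
  exact h.resolve_right (inv_ne_zero (Nat.cast_ne_zero.mpr (Nat.factorial_ne_zero _)))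

theorem exists_expEval_ne_zero {β : (Fin m → ℤ) →+ ℂ} (hβ : Function.Injective β)
    {x : Laurent ℂ m} (hx : x ≠ 0) : ∃ t, expEval β t x ≠ 0 := by
  by_contra! h
  let χ (a : Fin m → ℤ) : Multiplicative ℂ →* ℂ :=
    { toFun := fun t => Complex.exp (t.toAdd * β a)
      map_one' := by simp
      map_mul' := fun s t => by simp [add_mul, Complex.exp_add] }
  have hχ : Function.Injective χ := by
    intro a b hab
    -- The derivative at 0 recovers `β a` from the character `t ↦ e^{t β(a)}`.
    have h1 : HasDerivAt (fun t : ℂ => Complex.exp (t * β a)) (β a) 0 := by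
      simpa using ((hasDerivAt_id (0 : ℂ)).mul_const (β a)).cexp
    have h2 : HasDerivAt (fun t : ℂ => Complex.exp (t * β b)) (β b) 0 := by
      simpa using ((hasDerivAt_id (0 : ℂ)).mul_const (β b)).cexp
    have h3 : (fun t : ℂ => Complex.exp (t * β a)) = fun t : ℂ => Complex.exp (t * β b) :=
      funext fun t => DFunLike.congr_fun hab (Multiplicative.ofAdd t)
    exact hβ (h1.unique (h3 ▸ h2))
  exact hx (eq_zero_of_sum_monoidHom χ hχ x fun s => (expEval_apply β _ x).symm.trans (h s.toAdd))

/-- As a function of `t` the value is entire and not identically zero, so the identity theorem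
applies. -/
theorem expEval_ne_zero_mem_codiscrete {β : (Fin m → ℤ) →+ ℂ} (hβ : Function.Injective β)
    {x : Laurent ℂ m} (hx : x ≠ 0) : {t | expEval β t x ≠ 0} ∈ Filter.codiscrete ℂ := by
  obtain ⟨t, ht⟩ := exists_expEval_ne_zero hβ hx
  have han : AnalyticOnNhd ℂ (fun t => expEval β t x) Set.univ := by
    simp only [expEval_apply]
    exact Complex.analyticOnNhd_univ_iff_differentiable.mpr (by fun_prop)
  have := han.preimage_zero_mem_codiscrete ht
  exact this

end Specialize

/-! ## The Novikov ring -/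

section Novikov

variable {R : Type*} [CommRing R] {m : ℕ} {η : (Fin m → ℤ) →+ ℝ}

theorem laurentToNovikov_single (a b : NovExp η) (r : R) :
    (laurentToNovikov R η (AddMonoidAlgebra.single (M := Fin m → ℤ) a r)).1.coeff b =
      (AddMonoidAlgebra.single (M := Fin m → ℤ) a r).coeff b := by
  have h : laurentToNovikov R η (AddMonoidAlgebra.single (M := Fin m → ℤ) a r) =
      NovikovRing.monomial 0 r * NovikovRing.monomial (η := η) a 1 :=
    AddMonoidAlgebra.liftNC_single _ _ _ _
  have h' : (NovikovRing.monomial 0 r * NovikovRing.monomial (η := η) a 1 :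
      NovikovRing R η).1 = HahnSeries.single a r :=
    HahnSeries.single_mul_single.trans (by rw [zero_add, mul_one])
  classical
  rw [h, h', HahnSeries.coeff_single]
  exact (if_congr eq_comm rfl rfl).trans (Finsupp.single_apply (a := a) (a' := b) (b := r)).symm

theorem coeff_laurentToNovikov (x : Laurent R m) (a : Fin m → ℤ) :
    (laurentToNovikov R η x).1.coeff a = x.coeff a := by
  induction x using AddMonoidAlgebra.induction_linear with
  | zero => rw [map_zero]; rfl
  | add x y hx hy =>
    rw [map_add, AddMonoidAlgebra.coeff_add, Finsupp.add_apply, ← hx, ← hy]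
    rfl
  | single b r => exact laurentToNovikov_single b a r

theorem laurentToNovikov_injective : Function.Injective (laurentToNovikov R η) := by
  intro x y h
  refine AddMonoidAlgebra.coeff_injective (Finsupp.ext fun a => ?_)
  rw [← coeff_laurentToNovikov (η := η) x a, h, coeff_laurentToNovikov]

open Classical in
-- Injectivity of `η` makes the order by height total, and Hahn series over a linearly ordered
-- cancellative monoid with coefficients in a domain have no zero divisors.
theorem isDomain_novikovRing [IsDomain R] (hη : Function.Injective η) :
    IsDomain (NovikovRing R η) := by
  -- The linear order extends the existing partial order structure, so the Hahn series ring stays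
  -- the same.
  let _ : LinearOrder (NovExp η) :=
    { (inferInstance : PartialOrder (NovExp η)) with
      le_total := fun a b => by
        rcases lt_trichotomy (NovExp.height a) b.height with h | h | h
        · exact Or.inr (Or.inr h)
        · exact Or.inl (Or.inl (hη h))
        · exact Or.inl (Or.inr h)
      toDecidableLE := Classical.decRel _ }
  have : NoZeroDivisors (HahnSeries (NovExp η) R) := inferInstance
  have : Nontrivial (HahnSeries (NovExp η) R) := inferInstance
  have : IsDomain (HahnSeries (NovExp η) R) := NoZeroDivisors.to_isDomain _
  infer_instance

end Novikov

/-! ## The Betti numbers of the deformations -/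

section Main

open Topology

variable {X : Type*} [TopologicalSpace X] {x₀ : X} {l n m : ℕ}

/-- Every `γ_t` is a specialization of the single representation `ρ_p`: on the image of `g` in `ℤ^m`
the character `e^{tβ}` takes the value `e^{tα(g)}`. -/
theorem map_expEval_comp_repP (ρ : FundamentalGroup X x₀ →* GL (Fin l) ℂ)
    {α : Additive (FundamentalGroup X x₀) →+ ℂ} (θ : H1Free x₀ ≃* Multiplicative (Fin n → ℤ))
    (p : (Fin n → ℤ) →+ (Fin m → ℤ)) {β : (Fin m → ℤ) →+ ℂ}
    (hfac : ∀ g : FundamentalGroup X x₀,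
      α (Additive.ofMul g) = β (p (Multiplicative.toAdd (freeProj θ g)))) (t : ℂ) :
    (Matrix.GeneralLinearGroup.map (expEval β t : Laurent ℂ m →+* ℂ)).comp (repP ρ θ p) =
      expDeformation ρ α t := by
  rw [repP, laurentRep, map_comp_twist, expDeformation]
  congr 1
  refine MonoidHom.ext fun g => Units.ext ?_
  change expEval β t (AddMonoidAlgebra.of ℂ (Fin m → ℤ)
    (p.toMultiplicative (freeProj θ g))) = Complex.exp (t * α (Additive.ofMul g))
  rw [hfac, expEval, AddMonoidAlgebra.lift_of]
  rfl

theorem map_formalEval_comp_repP (ρ : FundamentalGroup X x₀ →* GL (Fin l) ℂ)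
    {α : Additive (FundamentalGroup X x₀) →+ ℂ} (θ : H1Free x₀ ≃* Multiplicative (Fin n → ℤ))
    (p : (Fin n → ℤ) →+ (Fin m → ℤ)) {β : (Fin m → ℤ) →+ ℂ}
    (hfac : ∀ g : FundamentalGroup X x₀,
      α (Additive.ofMul g) = β (p (Multiplicative.toAdd (freeProj θ g)))) :
    (Matrix.GeneralLinearGroup.map (formalEval β : Laurent ℂ m →+* PowerSeries ℂ)).comp
      (repP ρ θ p) = formalDeformation ρ α := by
  rw [repP, laurentRep, map_comp_twist, formalDeformation]
  congr 1
  refine MonoidHom.ext fun g => Units.ext ?_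
  change formalEval β (AddMonoidAlgebra.of ℂ (Fin m → ℤ)
    (p.toMultiplicative (freeProj θ g))) = formalExp (α (Additive.ofMul g))
  rw [hfac, formalEval, AddMonoidAlgebra.lift_of]
  rfl

variable [CWComplex (Set.univ : Set X)]

theorem bettiHomology_eq_finrank {B : Type*} [CommRing B]
    (σ : FundamentalGroup X x₀ →* GL (Fin l) B) (k : ℕ) :
    bettiHomology σ k = Module.finrank B (TwHomology σ k) :=
  finrank_fractionRing_tensorProduct

variable [RelCWComplex.Finite (Set.univ : Set X)]

theorem bettiCohomology_eq_bettiHomology {B : Type*} [CommRing B] [IsDomain B]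
    (σ : FundamentalGroup X x₀ →* GL (Fin l) B) (k : ℕ) :
    bettiCohomology σ k = bettiHomology (contragredient σ) k :=
  finrank_fractionRing_tensorProduct.trans
    ((finrank_twCohomology σ k).trans (bettiHomology_eq_finrank _ k).symm)

/-- `L_m` embeds both in `C` and in its fraction field, so both numbers equal the rank over `L_m`.
-/
theorem bettiHomology_map_repP_of_injective {R : Type*} [CommRing R] [IsDomain R]
    (ρ : FundamentalGroup X x₀ →* GL (Fin l) R)
    (θ : H1Free x₀ ≃* Multiplicative (Fin n → ℤ)) (p : (Fin n → ℤ) →+ (Fin m → ℤ))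
    {C : Type*} [CommRing C] [IsDomain C] (f : Laurent R m →+* C) (hf : Function.Injective f)
    (k : ℕ) :
    bettiHomology ((Matrix.GeneralLinearGroup.map f).comp (repP ρ θ p)) k =
      bettiLaurent ρ θ p k := by
  rw [bettiHomology_eq_finrank, finrank_twHomology_map_of_injective f hf, bettiLaurent,
    finrank_twHomology_map_of_injective _ (IsFractionRing.injective _ _)]

theorem bettiHomology_formalDeformation (ρ : FundamentalGroup X x₀ →* GL (Fin l) ℂ)
    {α : Additive (FundamentalGroup X x₀) →+ ℂ} (θ : H1Free x₀ ≃* Multiplicative (Fin n → ℤ))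
    (p : (Fin n → ℤ) →+ (Fin m → ℤ)) {β : (Fin m → ℤ) →+ ℂ} (hβ : Function.Injective β)
    (hfac : ∀ g : FundamentalGroup X x₀,
      α (Additive.ofMul g) = β (p (Multiplicative.toAdd (freeProj θ g)))) (k : ℕ) :
    bettiHomology (formalDeformation ρ α) k = bettiLaurent ρ θ p k := by
  rw [← map_formalEval_comp_repP ρ θ p hfac]
  exact bettiHomology_map_repP_of_injective ρ θ p _ (formalEval_injective hβ) k

theorem bettiCohomology_formalDeformation (ρ : FundamentalGroup X x₀ →* GL (Fin l) ℂ)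
    {α : Additive (FundamentalGroup X x₀) →+ ℂ} (θ : H1Free x₀ ≃* Multiplicative (Fin n → ℤ))
    (p : (Fin n → ℤ) →+ (Fin m → ℤ)) {β : (Fin m → ℤ) →+ ℂ} (hβ : Function.Injective β)
    (hfac : ∀ g : FundamentalGroup X x₀,
      α (Additive.ofMul g) = β (p (Multiplicative.toAdd (freeProj θ g)))) (k : ℕ) :
    bettiCohomology (formalDeformation ρ α) k = bettiLaurent (contragredient ρ) θ p k := by
  rw [bettiCohomology_eq_bettiHomology, contragredient_formalDeformation]
  -- The sign change affects only the last map of the factorization; `θ` and `p` stay the same.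
  exact bettiHomology_formalDeformation (contragredient ρ) θ p (β := -β)
    (neg_injective.comp hβ) (fun g => congrArg Neg.neg (hfac g)) k

theorem bettiHomology_expDeformation_mem_codiscrete
    (ρ : FundamentalGroup X x₀ →* GL (Fin l) ℂ)
    {α : Additive (FundamentalGroup X x₀) →+ ℂ} (θ : H1Free x₀ ≃* Multiplicative (Fin n → ℤ))
    (p : (Fin n → ℤ) →+ (Fin m → ℤ)) {β : (Fin m → ℤ) →+ ℂ} (hβ : Function.Injective β)
    (hfac : ∀ g : FundamentalGroup X x₀,
      α (Additive.ofMul g) = β (p (Multiplicative.toAdd (freeProj θ g)))) (k : ℕ) :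
    {t | bettiHomology (expDeformation ρ α t) k = bettiLaurent ρ θ p k} ∈
      Filter.codiscrete ℂ := by
  obtain ⟨b, hb, h⟩ := exists_ne_zero_finrank_twHomology_map_eq (repP ρ θ p) k
  refine Filter.mem_of_superset (expEval_ne_zero_mem_codiscrete hβ hb) fun t ht => ?_
  have h1 := h (expEval β t : Laurent ℂ m →+* ℂ) ht
  rw [map_expEval_comp_repP ρ θ p hfac t] at h1
  rw [Set.mem_ofPred_eq, bettiHomology_eq_finrank, h1, bettiLaurent,
    finrank_twHomology_map_of_injective _ (IsFractionRing.injective _ _)]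

theorem novikovBetti_eq_bettiLaurent {R : Type*} [CommRing R] [IsDomain R]
    (ρ : FundamentalGroup X x₀ →* GL (Fin l) R)
    (θ : H1Free x₀ ≃* Multiplicative (Fin n → ℤ)) (p : (Fin n → ℤ) →+ (Fin m → ℤ))
    {η : (Fin m → ℤ) →+ ℝ} (hη : Function.Injective η) (k : ℕ) :
    novikovBetti ρ θ p η k = bettiLaurent ρ θ p k :=
  have := isDomain_novikovRing (R := R) hη
  bettiHomology_map_repP_of_injective ρ θ p _ laurentToNovikov_injective k

end Main

end ExpDeform

end

open ExpDeform

theorem mainTheorem1 {X : Type*} [TopologicalSpace X] [T2Space X] [ConnectedSpace X]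
    [Topology.CWComplex (Set.univ : Set X)] [Topology.RelCWComplex.Finite (Set.univ : Set X)]
    (x₀ : X) {l : ℕ} (ρ : FundamentalGroup X x₀ →* GL (Fin l) ℂ)
    (α : Additive (FundamentalGroup X x₀) →+ ℂ)
    -- the factorization of `α` as `G → H_1(X, ℤ)/Tors ≅ ℤ^n → ℤ^m → ℂ` with `m = Irr α`
    {n : ℕ} (θ : ExpDeform.H1Free x₀ ≃* Multiplicative (Fin n → ℤ))
    (p : (Fin n → ℤ) →+ (Fin (ExpDeform.irr α) → ℤ)) (hp : Function.Surjective p)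
    (α' : (Fin (ExpDeform.irr α) → ℤ) →+ ℂ) (hα' : Function.Injective α')
    (hfac : ∀ g : FundamentalGroup X x₀,
      α (Additive.ofMul g) = α' (p (Multiplicative.toAdd (ExpDeform.freeProj θ g))))
    (k : ℕ) :
    -- the Betti numbers of `γ_t` for generic `t` are those of the formal deformation
    (∃ S : Set ℂ, IsClosed S ∧ IsDiscrete S ∧ ∀ t : ℂ, t ∉ S →
      ExpDeform.bettiHomology (ExpDeform.expDeformation ρ α t) k =
        ExpDeform.bettiHomology (ExpDeform.formalDeformation ρ α) k ∧
      ExpDeform.bettiCohomology (ExpDeform.expDeformation ρ α t) k =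
        ExpDeform.bettiCohomology (ExpDeform.formalDeformation ρ α) k) ∧
    -- they are the Betti numbers of the Laurent polynomial complex
    ExpDeform.bettiHomology (ExpDeform.formalDeformation ρ α) k =
      ExpDeform.bettiLaurent ρ θ p k ∧
    ExpDeform.bettiCohomology (ExpDeform.formalDeformation ρ α) k =
      ExpDeform.bettiLaurent (ExpDeform.contragredient ρ) θ p k ∧
    -- for real `α` they are the twisted Novikov Betti numbers
    (∀ ξ : Additive (FundamentalGroup X x₀) →+ ℝ,
      (∀ g : FundamentalGroup X x₀, α (Additive.ofMul g) = (ξ (Additive.ofMul g) : ℂ)) →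
      ∀ ξ' : (Fin (ExpDeform.irr α) → ℤ) →+ ℝ,
      (∀ g : FundamentalGroup X x₀,
        ξ (Additive.ofMul g) = ξ' (p (Multiplicative.toAdd (ExpDeform.freeProj θ g)))) →
      ExpDeform.bettiHomology (ExpDeform.formalDeformation ρ α) k =
        ExpDeform.novikovBetti ρ θ p ξ' k ∧
      ExpDeform.bettiCohomology (ExpDeform.formalDeformation ρ α) k =
        ExpDeform.novikovBetti (ExpDeform.contragredient ρ) θ p ξ' k) := by
  have hfac' : ∀ g : FundamentalGroup X x₀, (-α) (Additive.ofMul g) =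
      (-α') (p (Multiplicative.toAdd (freeProj θ g))) := fun g => congrArg Neg.neg (hfac g)
  have hform := bettiHomology_formalDeformation ρ θ p hα' hfac k
  have hcoform := bettiCohomology_formalDeformation ρ θ p hα' hfac k
  refine ⟨?_, hform, hcoform, fun ξ hξ ξ' hξ' => ?_⟩
  · have h₁ := bettiHomology_expDeformation_mem_codiscrete ρ θ p hα' hfac k
    have h₂ := bettiHomology_expDeformation_mem_codiscrete (contragredient ρ) θ p
      (β := -α') (neg_injective.comp hα') hfac' k
    -- A single exceptional set serves homology and cohomology: the complement of the set where both
    -- equalities hold.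
    have hmem := Filter.inter_mem h₁ h₂
    rw [mem_codiscrete'] at hmem
    refine ⟨_, hmem.1.isClosed_compl, hmem.2, fun t ht => ?_⟩
    obtain ⟨ht₁, ht₂⟩ := not_not.mp ht
    refine ⟨ht₁.trans hform.symm, ?_⟩
    rw [hcoform, bettiCohomology_eq_bettiHomology, contragredient_expDeformation]
    -- The contragredient changes the sign of `t`; moving the sign to `α` keeps the parameter `t`,
    -- as in `h₂`.
    have : expDeformation (contragredient ρ) α (-t) =
        expDeformation (contragredient ρ) (-α) t := by
      simp [expDeformation]
    rw [this]
    exact ht₂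
  · have hη : Function.Injective ξ' := by
      have hα : ∀ a, α' a = (ξ' a : ℂ) := by
        intro a
        obtain ⟨b, rfl⟩ := hp a
        obtain ⟨y, hy⟩ := θ.surjective (Multiplicative.ofAdd b)
        obtain ⟨z, rfl⟩ := QuotientGroup.mk'_surjective _ y
        obtain ⟨g, rfl⟩ := QuotientGroup.mk_surjective z
        have hg : Multiplicative.toAdd (freeProj θ g) = b := congrArg Multiplicative.toAdd hy
        rw [← hg, ← hfac, hξ, hξ']
      exact fun a b hab => hα' (by rw [hα, hα, hab])
    exact ⟨hform.trans (novikovBetti_eq_bettiLaurent ρ θ p hη k).symm,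
      hcoform.trans (novikovBetti_eq_bettiLaurent (contragredient ρ) θ p hη k).symm⟩
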